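/- Let $\mathcal H$ be a complex Hilbert space, with inner product linear in the second argument, and let $H_0$ be a self-adjoint operator in $\mathcal H$ that is bounded from below, with form domain $\mathfrak Q(H_0)$ and (closed) form $\langle\varphi,H_0\psi\rangle$, $\varphi,\psi\in\mathfrak Q(H_0)$. A closed operator $A$ in $\mathcal H$ with domain $\mathfrak D(A)$ is said to have $A^*A$ form bounded with respect to $H_0$ with constants $a,b\ge 0$ if $\mathfrak Q(H_0)\subseteq\mathfrak D(A)$ and $$\|A\psi\|^2\le a\,\langle\psi,H_0\psi\rangle+b\,\|\psi\|^2\qquad\text{for all }\psi\in\mathfrak Q(H_0).$$ The form bound is less than one if this holds for some $a<1$ and some $b$; $A^*A$ is infinitesimally form bounded if for every $a>0$ it holds for some $b$. Let $A_1,\dots,A_n$ be closed operators in $\mathcal H$ and let $S_1,\dots,S_n$ be bounded operators on $\mathcal H$ with $\|S_j\|\le 1$, such that * for each $j\le n-1$, either $A_j^*A_j$ is form bounded with respect to $H_0$ with form bound less than one and $S_j\ge 0$, or $A_j^*A_j$ is infinitesimally form bounded with respect to $H_0$; * $A_n^*A_n$ is form bounded with respect to $H_0$ with form bound less than one; * for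 each $j$, $A_j(H_0-z)^{-1}$ is Hilbert–Schmidt for one $z\in\rho(H_0)$. Let $[0,1]\ni\varepsilon\mapsto K_\varepsilon$ be a strongly continuous family of bounded self-adjoint operators on $\mathcal H$ with $0=K_0\le K_\varepsilon\le K_1=1$, such that $K_\varepsilon S_j$ is self-adjoint for all $\varepsilon$ and $j$ (that is, every $S_j$ is self-adjoint and commutes with every $K_\varepsilon$). Then for every $\varepsilon\in[0,1]$ the form sum $$H_\varepsilon=H_0+\sum_{j=1}^n A_j^*K_\varepsilon S_jA_j ,$$ i.e. the operator associated with the form $\langle\varphi,H_0\psi\rangle+\sum_{j=1}^n\langle A_j\varphi,K_\varepsilon S_jA_j\psi\rangle$ on $\mathfrak Q(H_0)$, is a well-defined self-adjoint operator. Moreover, for every $z\in\mathbb C\setminus\mathbb R$ and all $\varepsilon,\varepsilon'\in[0,1]$ the operator $(H_{\varepsilon'}-z)^{-1}-(H_\varepsilon-z)^{-1}$ is trace class, and $$\lim_{\varepsilon'\to\varepsilon}\big\|(H_{\varepsilon'}-z)^{-1}-(H_\varepsilon-z)^{-1}\big\|_{\mathcal J^1}=0\qquad\text{for every }\varepsilon\in[0,1].$$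 -/

import Mathlib

open Filter Topology
open scoped ENNReal InnerProductSpace

section ResolventConvergence

variable {E : Type*} [NormedAddCommGroup E] [InnerProductSpace ℂ E]

/-! ### Quadratic forms of semibounded operators -/

/-- `T` is symmetric. -/
def LinearPMap.IsSymm (T : E →ₗ.[ℂ] E) : Prop :=
  ∀ x y : T.domain, ⟪T x, (y : E)⟫_ℂ = ⟪(x : E), T y⟫_ℂ

/-- `T` is bounded from below: `⟨x, T x⟩ ≥ γ ‖x‖²` on the domain, for some real `γ`. -/
def LinearPMap.BddBelow (T : E →ₗ.[ℂ] E) : Prop :=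
  ∃ γ : ℝ, ∀ x : T.domain, γ * ‖(x : E)‖ ^ 2 ≤ (⟪(x : E), T x⟫_ℂ).re

/-- The sequence `u` in the domain of `T` converges to `ψ` and is Cauchy for the form
`⟨u, T u⟩`. -/
def LinearPMap.FormApprox (T : E →ₗ.[ℂ] E) (u : ℕ → T.domain) (ψ : E) : Prop :=
  Tendsto (fun n => (u n : E)) atTop (𝓝 ψ) ∧
  Tendsto (fun p : ℕ × ℕ => ⟪((u p.1 - u p.2 : T.domain) : E), T (u p.1 - u p.2)⟫_ℂ)
    atTop (𝓝 0)

/-- The form domain `𝔔(T)` of a semibounded self-adjoint operator `T`: the domain of the closure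
of the form `φ, ψ ↦ ⟨φ, T ψ⟩` defined on the domain of `T`. -/
def LinearPMap.formDomain (T : E →ₗ.[ℂ] E) : Set E :=
  {ψ | ∃ u, T.FormApprox u ψ}

open Classical in
/-- The closure of the form `φ, ψ ↦ ⟨φ, T ψ⟩`, on `𝔔(T)`: the limit of `⟨u n, T (v n)⟩` for
approximating sequences `u` of `φ` and `v` of `ψ`. For a symmetric semibounded `T` the limit
exists and does not depend on the sequences, see `LinearPMap.tendsto_form`. -/
noncomputable def LinearPMap.form (T : E →ₗ.[ℂ] E) (φ ψ : E) : ℂ :=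
  if h : ∃ z : ℂ, ∃ u v, T.FormApprox u φ ∧ T.FormApprox v ψ ∧
      Tendsto (fun n => ⟪(u n : E), T (v n)⟫_ℂ) atTop (𝓝 z)
  then h.choose else 0

/-- The nonnegative form `⟨x, T y⟩ - γ ⟨x, y⟩` on the domain of `T ≥ γ`. -/
noncomputable abbrev LinearPMap.shiftedCore (T : E →ₗ.[ℂ] E) (hT : T.IsSymm) (γ : ℝ)
    (hγ : ∀ x : T.domain, γ * ‖(x : E)‖ ^ 2 ≤ (⟪(x : E), T x⟫_ℂ).re) :
    PreInnerProductSpace.Core ℂ T.domain where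
  inner x y := ⟪(x : E), T y⟫_ℂ - γ * ⟪(x : E), (y : E)⟫_ℂ
  conj_inner_symm x y := by
    show (starRingEnd ℂ) (⟪(y : E), T x⟫_ℂ - γ * ⟪(y : E), (x : E)⟫_ℂ) =
      ⟪(x : E), T y⟫_ℂ - γ * ⟪(x : E), (y : E)⟫_ℂ
    rw [_root_.map_sub, _root_.map_mul, inner_conj_symm, inner_conj_symm, Complex.conj_ofReal, hT]
  re_inner_nonneg x := by
    have h := hγ x
    have h2 : ((γ : ℂ) * ⟪(x : E), (x : E)⟫_ℂ).re = γ * ‖(x : E)‖ ^ 2 := by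
      rw [Complex.re_ofReal_mul]
      congr 1
      exact inner_self_eq_norm_sq (𝕜 := ℂ) (x : E)
    show 0 ≤ (_ - _ : ℂ).re
    rw [Complex.sub_re, h2]
    linarith
  add_left x y z := by
    simp only [Submodule.coe_add, inner_add_left]
    ring
  smul_left x y r := by
    simp only [Submodule.coe_smul, inner_smul_left]
    ring

/-- Abstract form of `LinearPMap.tendsto_form`, for a nonnegative form on a vector space. -/
theorem exists_tendsto_core.{w} {V : Type w} [AddCommGroup V] [Module ℂ V]
    (c : PreInnerProductSpace.Core ℂ V) (ι S : V →ₗ[ℂ] E) (γ : ℂ)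
    (hc : ∀ x y, c.inner x y = ⟪ι x, S y⟫_ℂ - γ * ⟪ι x, ι y⟫_ℂ) :
    ∃ (W : Type w) (_ : NormedAddCommGroup W) (_ : InnerProductSpace ℂ W) (J : V → W),
      (∀ x y, c.inner x y = ⟪J x, J y⟫_ℂ) ∧
      ∀ φ : E, ∀ u : ℕ → V, Tendsto (fun n => ι (u n)) atTop (𝓝 φ) →
        Tendsto (fun p : ℕ × ℕ => ⟪ι (u p.1 - u p.2), S (u p.1 - u p.2)⟫_ℂ) atTop (𝓝 0) →
        ∃ U : W, Tendsto (fun n => J (u n)) atTop (𝓝 U) ∧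
        ∀ u' : ℕ → V, Tendsto (fun n => ι (u' n)) atTop (𝓝 φ) →
        Tendsto (fun p : ℕ × ℕ => ⟪ι (u' p.1 - u' p.2), S (u' p.1 - u' p.2)⟫_ℂ) atTop (𝓝 0) →
          Tendsto (fun n => J (u' n)) atTop (𝓝 U) := by
  let iN : SeminormedAddCommGroup V := @InnerProductSpace.Core.toSeminormedAddCommGroup ℂ V _ _ _ c
  let iI : InnerProductSpace ℂ V := InnerProductSpace.ofCore c
  have hi : ∀ x y : V, ⟪x, y⟫_ℂ = ⟪ι x, S y⟫_ℂ - γ * ⟪ι x, ι y⟫_ℂ := hc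
  have hsq : ∀ x : V, ‖x‖ ^ 2 = ‖⟪x, x⟫_ℂ‖ := fun x => by
    rw [inner_self_eq_norm_sq_to_K, norm_pow]; simp
  -- the form-Cauchy sequences converge in the completion
  have key : ∀ φ : E, ∀ u : ℕ → V, Tendsto (fun n => ι (u n)) atTop (𝓝 φ) →
      Tendsto (fun p : ℕ × ℕ => ⟪ι (u p.1 - u p.2), S (u p.1 - u p.2)⟫_ℂ) atTop (𝓝 0) →
      ∃ U : UniformSpace.Completion V,
        Tendsto (fun n => (u n : UniformSpace.Completion V)) atTop (𝓝 U) := by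
    intro φ u h1 h2
    have hcs : CauchySeq u := by
      rw [cauchySeq_iff_tendsto_dist_atTop_0]
      have h3 : Tendsto (fun p : ℕ × ℕ => ι (u p.1 - u p.2)) atTop (𝓝 0) := by
        have ha : Tendsto (fun p : ℕ × ℕ => ι (u p.1)) atTop (𝓝 φ) := by
          rw [← prod_atTop_atTop_eq]; exact h1.comp tendsto_fst
        have hb : Tendsto (fun p : ℕ × ℕ => ι (u p.2)) atTop (𝓝 φ) := by
          rw [← prod_atTop_atTop_eq]; exact h1.comp tendsto_snd
        simpa using ha.sub hb
      have h4 : Tendsto (fun p : ℕ × ℕ => ⟪u p.1 - u p.2, u p.1 - u p.2⟫_ℂ) atTop (𝓝 0) := by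
        have := h2.sub ((h3.inner (𝕜 := ℂ) h3).const_mul γ)
        simp only [inner_zero_left, mul_zero, sub_zero] at this
        exact this.congr fun p => (hi _ _).symm
      have h5 : Tendsto (fun p : ℕ × ℕ => ‖u p.1 - u p.2‖ ^ 2) atTop (𝓝 0) := by
        have := h4.norm
        simp only [norm_zero] at this
        exact this.congr fun p => (hsq _).symm
      have h6 := h5.sqrt
      simp only [Real.sqrt_zero] at h6
      refine h6.congr fun p => ?_
      rw [Real.sqrt_sq (norm_nonneg _), dist_eq_norm]
    exact cauchySeq_tendsto_of_complete (hcs.map (UniformSpace.Completion.uniformContinuous_coe V))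
  refine ⟨UniformSpace.Completion V, inferInstance, inferInstance, fun x => x, ?_, ?_⟩
  · intro x y
    rw [UniformSpace.Completion.inner_coe]
  · intro φ u h1 h2
    obtain ⟨U, hU⟩ := key φ u h1 h2
    refine ⟨U, hU, fun u' h1' h2' => ?_⟩
    obtain ⟨U', hU'⟩ := key φ u' h1' h2'
    suffices h : U' - U = 0 by rwa [← sub_eq_zero.mp h]
    -- the difference is orthogonal to a dense set
    have horth : ∀ x : V, ⟪(x : UniformSpace.Completion V), U' - U⟫_ℂ = 0 := by
      intro x
      have ha : Tendsto (fun n => ⟪(x : UniformSpace.Completion V),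
          (u' n : UniformSpace.Completion V) - (u n : UniformSpace.Completion V)⟫_ℂ) atTop
          (𝓝 ⟪(x : UniformSpace.Completion V), U' - U⟫_ℂ) :=
        tendsto_const_nhds.inner (hU'.sub hU)
      refine tendsto_nhds_unique ha ?_
      have hz : Tendsto (fun n => ι (u' n - u n)) atTop (𝓝 0) := by
        simpa using h1'.sub h1
      have hb : Tendsto (fun n => ⟪u' n - u n, x⟫_ℂ) atTop (𝓝 0) := by
        have := (hz.inner (𝕜 := ℂ) (tendsto_const_nhds (x := S x))).sub
          ((hz.inner (𝕜 := ℂ) (tendsto_const_nhds (x := ι x))).const_mul γ)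
        simp only [inner_zero_left, mul_zero, sub_zero] at this
        exact this.congr fun n => (hi _ _).symm
      have hd := (Complex.continuous_conj.tendsto 0).comp hb
      simp only [map_zero] at hd
      refine hd.congr fun n => ?_
      simp only [Function.comp]
      rw [← UniformSpace.Completion.coe_sub, UniformSpace.Completion.inner_coe]
      exact inner_conj_symm _ _
    have hall : ∀ y : UniformSpace.Completion V, ⟪y, U' - U⟫_ℂ = 0 := by
      intro y
      refine UniformSpace.Completion.induction_on y ?_ horth
      exact isClosed_eq (continuous_id.inner continuous_const) continuous_const
    exact inner_self_eq_zero.mp (hall _)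

/-- Along any two approximating sequences the values of the form converge to `T.form φ ψ`. -/
theorem LinearPMap.tendsto_form {T : E →ₗ.[ℂ] E} (hT : T.IsSymm) (hb : T.BddBelow)
    {u v : ℕ → T.domain} {φ ψ : E} (hu : T.FormApprox u φ) (hv : T.FormApprox v ψ) :
    Tendsto (fun n => ⟪(u n : E), T (v n)⟫_ℂ) atTop (𝓝 (T.form φ ψ)) := by
  obtain ⟨γ, hγ⟩ := hb
  obtain ⟨W, _, _, J, hJ, hlim⟩ := exists_tendsto_core (T.shiftedCore hT γ hγ)
    T.domain.subtype T.toFun γ (fun _ _ => rfl)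
  obtain ⟨U, -, hU⟩ := hlim φ u hu.1 hu.2
  obtain ⟨V, -, hV⟩ := hlim ψ v hv.1 hv.2
  have gen : ∀ u' v', T.FormApprox u' φ → T.FormApprox v' ψ →
      Tendsto (fun n => ⟪(u' n : E), T (v' n)⟫_ℂ) atTop (𝓝 (⟪U, V⟫_ℂ + γ * ⟪φ, ψ⟫_ℂ)) := by
    intro u' v' hu' hv'
    have h := ((hU u' hu'.1 hu'.2).inner (𝕜 := ℂ) (hV v' hv'.1 hv'.2)).add
      ((hu'.1.inner (𝕜 := ℂ) hv'.1).const_mul (γ : ℂ))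
    refine h.congr fun n => ?_
    rw [← hJ]
    show (⟪(u' n : E), T (v' n)⟫_ℂ - γ * ⟪(u' n : E), (v' n : E)⟫_ℂ) + _ = _
    ring
  have hex : ∃ z : ℂ, ∃ u v, T.FormApprox u φ ∧ T.FormApprox v ψ ∧
      Tendsto (fun n => ⟪(u n : E), T (v n)⟫_ℂ) atTop (𝓝 z) :=
    ⟨_, u, v, hu, hv, gen u v hu hv⟩
  have hval : T.form φ ψ = ⟪U, V⟫_ℂ + γ * ⟪φ, ψ⟫_ℂ := by
    rw [LinearPMap.form, dif_pos hex]
    obtain ⟨u', v', hu', hv', hlim'⟩ := hex.choose_spec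
    exact tendsto_nhds_unique hlim' (gen u' v' hu' hv')
  rw [hval]
  exact gen u v hu hv

/-- The form `⟨φ, A^* A ψ⟩ = ⟨A φ, A ψ⟩`, whose form domain is the domain of the closed operator
`A`, is bounded relative to the form of `T` with constants `a`, `b`. -/
def LinearPMap.IsFormBoundedWith (A T : E →ₗ.[ℂ] E) (a b : ℝ) : Prop :=
  ∀ ψ ∈ T.formDomain, ∃ h : ψ ∈ A.domain,
    ‖A ⟨ψ, h⟩‖ ^ 2 ≤ a * (T.form ψ ψ).re + b * ‖ψ‖ ^ 2

/-- `A^* A` is form bounded relative to `T` with form bound less than one. -/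
def LinearPMap.IsFormBoundedLTOne (A T : E →ₗ.[ℂ] E) : Prop :=
  ∃ a b : ℝ, 0 ≤ a ∧ a < 1 ∧ 0 ≤ b ∧ A.IsFormBoundedWith T a b

/-- `A^* A` is infinitesimally form bounded relative to `T`. -/
def LinearPMap.IsInfFormBounded (A T : E →ₗ.[ℂ] E) : Prop :=
  ∀ a : ℝ, 0 < a → ∃ b : ℝ, 0 ≤ b ∧ A.IsFormBoundedWith T a b

/-- `H` is the form sum `T + ∑ j, (A j)^* (B j) (A j)`: the operator associated with the form
`h(φ, ψ) = ⟨φ, T ψ⟩ + ∑ j, ⟨A j φ, B j (A j ψ)⟩` on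
`𝔔 = 𝔔(T) ∩ ⋂ j, dom (A j)`. That is, `ψ` is in the domain of `H` with `H ψ = w` exactly if
`ψ ∈ 𝔔` and `h(φ, ψ) = ⟨φ, w⟩` for all `φ ∈ 𝔔`. -/
def LinearPMap.IsFormSum {n : ℕ} (T : E →ₗ.[ℂ] E) (A : Fin n → E →ₗ.[ℂ] E)
    (B : Fin n → E →L[ℂ] E) (H : E →ₗ.[ℂ] E) : Prop :=
  ∀ ψ w : E, (ψ, w) ∈ H.graph ↔
    ψ ∈ T.formDomain ∧ ∃ hψ : ∀ j, ψ ∈ (A j).domain,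
      ∀ φ ∈ T.formDomain, ∀ hφ : ∀ j, φ ∈ (A j).domain,
        T.form φ ψ + ∑ j, ⟪A j ⟨φ, hφ j⟩, B j (A j ⟨ψ, hψ j⟩)⟫_ℂ = ⟪φ, w⟫_ℂ

/-! ### Resolvents -/

/-- `z` is in the resolvent set of `T`, and `R = (T - z)⁻¹`. -/
def LinearPMap.IsResolventAt (T : E →ₗ.[ℂ] E) (z : ℂ) (R : E →L[ℂ] E) : Prop :=
  (∀ x : E, ∃ h : R x ∈ T.domain, T ⟨R x, h⟩ - z • R x = x) ∧
  ∀ x : T.domain, R (T x - z • (x : E)) = x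

/-! ### Schatten classes -/

/-- `T` is a Hilbert-Schmidt operator: `∑ ‖T b i‖² < ∞` for some (equivalently, every)
orthonormal basis. -/
def IsHilbertSchmidt (T : E →L[ℂ] E) : Prop :=
  ∃ (s : Set E) (b : HilbertBasis s ℂ E), Summable fun i => ‖T (b i)‖ ^ 2

/-- The trace norm `tr |T| = ∑ ⟨b i, |T| b i⟩`, with value `∞` if `T` is not trace class. The sum
is the same for every orthonormal basis `b`, so that the supremum only avoids a choice. -/
noncomputable def traceNorm [CompleteSpace E] (T : E →L[ℂ] E) : ℝ≥0∞ :=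
  ⨆ (s : Set E) (b : HilbertBasis s ℂ E),
    ∑' i, ENNReal.ofReal (⟪b i, CFC.abs T (b i)⟫_ℂ).re

end ResolventConvergence

/-!
Everything is expressed through the bounded operator `Q = (H₀ + λ)^(-1/2)` for a large `λ`. The
form domain of `H₀` is the range of `Q`, and `⟨Q f, H₀ Q g⟩ = ⟨f, g⟩ - λ ⟨Q f, Q g⟩`
(`LinearPMap.IsInvSqrt.form_apply`). Form boundedness says that `Cⱼ = Aⱼ Q` is a bounded operator,
with a norm controlled by the form bound when `λ` is large, and the Hilbert–Schmidt hypothesis says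
that `Cⱼ Q` is Hilbert–Schmidt.

The form of `H_ε + λ` at `Q f, Q g` is `⟨f, M_ε g⟩` with `M_ε = 1 + ∑ Cⱼ* K_ε Sⱼ Cⱼ`. The terms
with `Sⱼ ≥ 0` are nonnegative, as `K_ε` and `Sⱼ` commute, and the others have norms with sum less than
one; so `M_ε` is bounded below by a positive constant that does not depend on `ε`, and
`(H_ε + λ)⁻¹ = Q M_ε⁻¹ Q` defines the self-adjoint form sum
(`LinearPMap.IsInvSqrt.isFormSum_ofResolvent`, `LinearPMap.isSelfAdjoint_ofResolvent`).

With `F_{j,ε} = Cⱼ M_ε⁻¹ Q` the resolvents at `-λ` differ by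
`- ∑ F_{j,ε'}* (K_ε' - K_ε) Sⱼ F_{j,ε}`, and bounded factors `(1 - (z + λ) (H_ε + λ)⁻¹)⁻¹`,
uniform in `ε`, carry this over to any nonreal `z` (`resolvent_sub_eq_sum`). The Hilbert–Schmidt
norms of `F_{j,ε}` are bounded uniformly in `ε` (`hilbertSchmidtSq_mul_inverse_le`), while
`(K_ε' - K_ε) Sⱼ F_{j,ε}` tends to zero in Hilbert–Schmidt norm as `ε' → ε`, because strong
convergence becomes norm convergence after multiplication by a fixed Hilbert–Schmidt operator
(`tendsto_hilbertSchmidtSq_mul`). The Cauchy–Schwarz inequality for the trace norm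
(`traceNorm_sum_adjoint_mul_le`) concludes.
-/

/-! ### Hilbert–Schmidt norms and the trace norm -/

section HilbertSchmidt

variable {E : Type*} [NormedAddCommGroup E] [InnerProductSpace ℂ E]

/-- The squared Hilbert–Schmidt norm `∑ ‖T (b i)‖²` of `T`, computed in the orthonormal basis `b`,
with value `∞` if `T` is not Hilbert–Schmidt. -/
noncomputable def hilbertSchmidtSq {ι : Type*} (b : HilbertBasis ι ℂ E) (T : E →L[ℂ] E) : ℝ≥0∞ :=
  ∑' i, ‖T (b i)‖ₑ ^ 2

theorem HilbertBasis.tsum_enorm_inner_sq {ι : Type*} (b : HilbertBasis ι ℂ E) (x : E) :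
    ∑' i, ‖⟪b i, x⟫_ℂ‖ₑ ^ 2 = ‖x‖ₑ ^ 2 := by
  have h := (b.hasSum_inner_mul_inner x x).mapL Complex.reCLM
  have h1 : ∀ i, Complex.reCLM (⟪x, b i⟫_ℂ * ⟪b i, x⟫_ℂ) = ‖⟪b i, x⟫_ℂ‖ ^ 2 := by
    intro i
    rw [← inner_conj_symm, RCLike.conj_mul]
    simp [← Complex.ofReal_pow]
  have h2 : Complex.reCLM ⟪x, x⟫_ℂ = ‖x‖ ^ 2 := inner_self_eq_norm_sq (𝕜 := ℂ) x
  rw [h2] at h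
  simp only [h1] at h
  have h3 := ENNReal.ofReal_tsum_of_nonneg (fun i => by positivity) h.summable
  rw [h.tsum_eq] at h3
  simpa [ENNReal.ofReal_pow, ofReal_norm] using h3.symm

theorem hilbertSchmidtSq_adjoint [CompleteSpace E] {ι κ : Type*} (b : HilbertBasis ι ℂ E)
    (b' : HilbertBasis κ ℂ E) (T : E →L[ℂ] E) :
    hilbertSchmidtSq b T.adjoint = hilbertSchmidtSq b' T := by
  unfold hilbertSchmidtSq
  calc ∑' i, ‖T.adjoint (b i)‖ₑ ^ 2
      = ∑' i, ∑' k, ‖⟪b' k, T.adjoint (b i)⟫_ℂ‖ₑ ^ 2 := by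
        simp only [HilbertBasis.tsum_enorm_inner_sq]
    _ = ∑' k, ∑' i, ‖⟪b' k, T.adjoint (b i)⟫_ℂ‖ₑ ^ 2 := ENNReal.tsum_comm
    _ = ∑' k, ∑' i, ‖⟪b i, T (b' k)⟫_ℂ‖ₑ ^ 2 := by
        refine tsum_congr fun k => tsum_congr fun i => ?_
        rw [ContinuousLinearMap.adjoint_inner_right, ← inner_conj_symm, RCLike.enorm_conj]
    _ = _ := by simp only [HilbertBasis.tsum_enorm_inner_sq]

theorem hilbertSchmidtSq_eq [CompleteSpace E] {ι κ : Type*} (b : HilbertBasis ι ℂ E)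
    (b' : HilbertBasis κ ℂ E) (T : E →L[ℂ] E) : hilbertSchmidtSq b T = hilbertSchmidtSq b' T := by
  rw [← hilbertSchmidtSq_adjoint b b, hilbertSchmidtSq_adjoint b b']

theorem IsHilbertSchmidt.hilbertSchmidtSq_lt_top [CompleteSpace E] {T : E →L[ℂ] E}
    (hT : IsHilbertSchmidt T) {ι : Type*} (b : HilbertBasis ι ℂ E) : hilbertSchmidtSq b T < ∞ := by
  obtain ⟨s, b', h⟩ := hT
  rw [hilbertSchmidtSq_eq b b', hilbertSchmidtSq]
  have := h.tsum_ofReal_lt_top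
  simpa [ENNReal.ofReal_pow, ofReal_norm] using this

theorem hilbertSchmidtSq_le_sum {ι κ : Type*} [Fintype κ] (b : HilbertBasis ι ℂ E) {c : ℝ}
    (T : E →L[ℂ] E) (S : κ → E →L[ℂ] E) (h : ∀ x, ‖T x‖ ≤ c * ∑ k, ‖S k x‖) :
    hilbertSchmidtSq b T ≤
      ENNReal.ofReal (c ^ 2 * Fintype.card κ) * ∑ k, hilbertSchmidtSq b (S k) := by
  unfold hilbertSchmidtSq
  rw [← Summable.tsum_finsetSum fun _ _ => ENNReal.summable, ← ENNReal.tsum_mul_left]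
  refine ENNReal.tsum_le_tsum fun i => ?_
  have h1 : ‖T (b i)‖ ^ 2 ≤ (c ^ 2 * Fintype.card κ) * ∑ k, ‖S k (b i)‖ ^ 2 := by
    calc ‖T (b i)‖ ^ 2 ≤ (c * ∑ k, ‖S k (b i)‖) ^ 2 := by gcongr; exact h _
      _ = c ^ 2 * (∑ k, ‖S k (b i)‖) ^ 2 := by ring
      _ ≤ c ^ 2 * (Fintype.card κ * ∑ k, ‖S k (b i)‖ ^ 2) := by
        gcongr
        exact sq_sum_le_card_mul_sum_sq
      _ = _ := by ring
  have h2 := ENNReal.ofReal_le_ofReal h1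
  rw [ENNReal.ofReal_mul (by positivity),
    ENNReal.ofReal_sum_of_nonneg (fun _ _ => by positivity)] at h2
  simpa only [ENNReal.ofReal_pow (norm_nonneg _), ofReal_norm] using h2

theorem hilbertSchmidtSq_le_of_norm_le {ι : Type*} (b : HilbertBasis ι ℂ E) {c : ℝ}
    (T S : E →L[ℂ] E) (h : ∀ x, ‖T x‖ ≤ c * ‖S x‖) :
    hilbertSchmidtSq b T ≤ ENNReal.ofReal (c ^ 2) * hilbertSchmidtSq b S := by
  simpa using hilbertSchmidtSq_le_sum b T (fun _ : Unit => S) (by simpa using h)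

theorem hilbertSchmidtSq_mul_right_le [CompleteSpace E] {ι : Type*} (b : HilbertBasis ι ℂ E)
    (T V : E →L[ℂ] E) :
    hilbertSchmidtSq b (T * V) ≤ ENNReal.ofReal (‖V‖ ^ 2) * hilbertSchmidtSq b T := by
  rw [← hilbertSchmidtSq_adjoint b b, ← hilbertSchmidtSq_adjoint b b T]
  refine hilbertSchmidtSq_le_of_norm_le b _ _ fun x => ?_
  have : (T * V).adjoint x = V.adjoint (T.adjoint x) := by
    rw [ContinuousLinearMap.mul_def, ContinuousLinearMap.adjoint_comp]; rfl
  rw [this, ← LinearIsometryEquiv.norm_map ContinuousLinearMap.adjoint V]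
  exact V.adjoint.le_opNorm _

theorem enorm_tsum_inner_le {ι : Type*} (f g : ι → E) :
    ∑' i, ‖⟪f i, g i⟫_ℂ‖ₑ ≤ (∑' i, ‖f i‖ₑ ^ 2) ^ (1 / 2 : ℝ) * (∑' i, ‖g i‖ₑ ^ 2) ^ (1 / 2 : ℝ) := by
  rw [ENNReal.tsum_eq_iSup_sum]
  refine iSup_le fun s => ?_
  calc ∑ i ∈ s, ‖⟪f i, g i⟫_ℂ‖ₑ ≤ ∑ i ∈ s, ‖f i‖ₑ * ‖g i‖ₑ := by
        refine Finset.sum_le_sum fun i _ => ?_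
        simp only [enorm_eq_nnnorm]
        exact_mod_cast nnnorm_inner_le_nnnorm (𝕜 := ℂ) (f i) (g i)
    _ ≤ (∑ i ∈ s, ‖f i‖ₑ ^ (2 : ℝ)) ^ (1 / 2 : ℝ) * (∑ i ∈ s, ‖g i‖ₑ ^ (2 : ℝ)) ^ (1 / 2 : ℝ) :=
        ENNReal.inner_le_Lp_mul_Lq s _ _ Real.HolderConjugate.two_two
    _ ≤ _ := by
        simp only [ENNReal.rpow_two]
        gcongr <;> exact ENNReal.sum_le_tsum _

/-- The part of the polar decomposition that the trace norm needs: `|T| = V T` for a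
contraction `V`. It is the extension of `T x ↦ |T| x` from the range of `T`, by continuity to the
closure and by zero to the orthogonal complement. -/
theorem exists_contraction_mul_eq_abs [CompleteSpace E] (T : E →L[ℂ] E) :
    ∃ V : E →L[ℂ] E, ‖V‖ ≤ 1 ∧ V * T = CFC.abs T := by
  have hnorm : ∀ x, ‖CFC.abs T x‖ = ‖T x‖ := by
    intro x
    have hsa : (CFC.abs T).adjoint = CFC.abs T := (CFC.abs_nonneg T).isSelfAdjoint
    have h : ⟪CFC.abs T x, CFC.abs T x⟫_ℂ = ⟪T x, T x⟫_ℂ := by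
      rw [← ContinuousLinearMap.adjoint_inner_right, hsa, ← mul_apply_eq_comp,
        CFC.abs_mul_abs, mul_apply_eq_comp, ContinuousLinearMap.star_eq_adjoint,
        ContinuousLinearMap.adjoint_inner_right]
    rw [inner_self_eq_norm_sq_to_K, inner_self_eq_norm_sq_to_K] at h
    have h' : ‖CFC.abs T x‖ ^ 2 = ‖T x‖ ^ 2 := by exact_mod_cast h
    exact (sq_eq_sq₀ (norm_nonneg _) (norm_nonneg _)).mp h'
  let W : Submodule ℂ E := T.range.topologicalClosure
  have : CompleteSpace W := T.range.isClosed_topologicalClosure.completeSpace_coe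
  let e : E →ₗ[ℂ] W :=
    T.toLinearMap.codRestrict W fun x => T.range.le_topologicalClosure ⟨x, rfl⟩
  have hd : DenseRange e := by
    intro y
    rw [closure_subtype]
    refine closure_mono ?_ y.2
    rintro _ ⟨x, rfl⟩
    exact ⟨e x, ⟨x, rfl⟩, rfl⟩
  have hb : ∀ x, ‖(CFC.abs T).toLinearMap x‖ ≤ 1 * ‖e x‖ := by
    intro x
    rw [one_mul]
    exact (hnorm x).le
  refine ⟨((CFC.abs T).toLinearMap.extendOfNorm e).comp W.orthogonalProjectionOnto, ?_, ?_⟩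
  · refine (ContinuousLinearMap.opNorm_comp_le _ _).trans ?_
    exact mul_le_one₀ (LinearMap.opNorm_extendOfNorm_le hd zero_le_one hb) (norm_nonneg _)
      W.orthogonalProjectionOnto_norm_le
  · ext x
    have : W.orthogonalProjectionOnto (T x) = e x :=
      W.orthogonalProjectionOnto_mem_subspace_eq_self (e x)
    simp only [mul_apply_eq_comp, ContinuousLinearMap.comp_apply, this]
    exact LinearMap.extendOfNorm_eq hd ⟨1, hb⟩ x

/-- The Cauchy–Schwarz inequality `‖∑ Xₖ* Yₖ‖₁ ≤ ∑ ‖Xₖ‖₂ ‖Yₖ‖₂`. Treating the sum at once makes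
the triangle inequality of the trace norm unnecessary. -/
theorem traceNorm_sum_adjoint_mul_le [CompleteSpace E] {ι κ : Type*} [Fintype κ]
    (b : HilbertBasis ι ℂ E) (X Y : κ → E →L[ℂ] E) :
    traceNorm (∑ k, (X k).adjoint * Y k) ≤
      ∑ k, hilbertSchmidtSq b (X k) ^ (1 / 2 : ℝ) * hilbertSchmidtSq b (Y k) ^ (1 / 2 : ℝ) := by
  obtain ⟨V, hV, hVT⟩ := exists_contraction_mul_eq_abs (∑ k, (X k).adjoint * Y k)
  refine iSup_le fun s => iSup_le fun b' => ?_
  have hV' : ‖V.adjoint‖ ≤ 1 := by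
    rwa [LinearIsometryEquiv.norm_map ContinuousLinearMap.adjoint V]
  calc ∑' i, ENNReal.ofReal (⟪b' i, CFC.abs (∑ k, (X k).adjoint * Y k) (b' i)⟫_ℂ).re
      ≤ ∑' i, ∑ k, ‖⟪(X k * V.adjoint) (b' i), Y k (b' i)⟫_ℂ‖ₑ := by
        refine ENNReal.tsum_le_tsum fun i => ?_
        rw [← hVT]
        have : ⟪b' i, (V * ∑ k, (X k).adjoint * Y k) (b' i)⟫_ℂ =
            ∑ k, ⟪(X k * V.adjoint) (b' i), Y k (b' i)⟫_ℂ := by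
          rw [mul_apply_eq_comp, sum_apply,
            ← ContinuousLinearMap.adjoint_inner_left, inner_sum]
          refine Finset.sum_congr rfl fun k _ => ?_
          rw [mul_apply_eq_comp, ContinuousLinearMap.adjoint_inner_right]
          rfl
        rw [this]
        refine le_trans ?_ (enorm_sum_le _ _)
        rw [← ofReal_norm]
        exact ENNReal.ofReal_le_ofReal (Complex.re_le_norm _)
    _ = ∑ k, ∑' i, ‖⟪(X k * V.adjoint) (b' i), Y k (b' i)⟫_ℂ‖ₑ :=
        Summable.tsum_finsetSum fun _ _ => ENNReal.summable
    _ ≤ _ := by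
        refine Finset.sum_le_sum fun k _ => (enorm_tsum_inner_le _ _).trans ?_
        have hX : hilbertSchmidtSq b' (X k * V.adjoint) ≤ hilbertSchmidtSq b (X k) := by
          rw [hilbertSchmidtSq_eq b b']
          refine (hilbertSchmidtSq_mul_right_le b' (X k) V.adjoint).trans ?_
          refine mul_le_of_le_one_left' ?_
          rw [ENNReal.ofReal_le_one]
          exact pow_le_one₀ (norm_nonneg _) hV'
        have hY := (hilbertSchmidtSq_eq b' b (Y k)).le
        unfold hilbertSchmidtSq at hX hY ⊢
        gcongr

/-- A strongly convergent bounded family of operators converges in Hilbert–Schmidt norm after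
multiplication from the right by a fixed Hilbert–Schmidt operator. -/
theorem tendsto_hilbertSchmidtSq_mul {α ι : Type*} {l : Filter α} (b : HilbertBasis ι ℂ E)
    {D : α → E →L[ℂ] E} {c : ℝ} (hD : ∀ x, Tendsto (fun a => D a x) l (𝓝 0))
    (hc : ∀ a x, ‖D a x‖ ≤ c * ‖x‖) {T : E →L[ℂ] E} (hT : hilbertSchmidtSq b T < ∞) :
    Tendsto (fun a => hilbertSchmidtSq b (D a * T)) l (𝓝 0) := by
  have hs : Summable fun i => ‖T (b i)‖ ^ 2 := by
    have := ENNReal.summable_toReal hT.ne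
    simpa [ENNReal.toReal_pow] using this
  have hle : ∀ a i, ‖(D a * T) (b i)‖ ^ 2 ≤ c ^ 2 * ‖T (b i)‖ ^ 2 := fun a i => by
    rw [← mul_pow]
    gcongr
    exact hc a _
  have h := tendsto_tsum_of_dominated_convergence (𝓕 := l)
    (f := fun a i => ‖(D a * T) (b i)‖ ^ 2) (g := fun _ => (0 : ℝ)) (hs.mul_left (c ^ 2))
    (fun i => by simpa using ((hD (T (b i))).norm.pow 2))
    (Eventually.of_forall fun a i => by
      rw [Real.norm_of_nonneg (by positivity)]
      exact hle a i)
  have h2 := ENNReal.tendsto_ofReal h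
  simp only [tsum_zero, ENNReal.ofReal_zero] at h2
  refine h2.congr fun a => ?_
  rw [ENNReal.ofReal_tsum_of_nonneg (fun _ => by positivity)
    (Summable.of_nonneg_of_le (fun _ => by positivity) (hle a) (hs.mul_left (c ^ 2)))]
  simp only [hilbertSchmidtSq, ENNReal.ofReal_pow (norm_nonneg _), ofReal_norm]

end HilbertSchmidt

/-! ### Inverses of operators and resolvents -/

section Resolvent

variable {E : Type*} [NormedAddCommGroup E] [InnerProductSpace ℂ E]

theorem ContinuousLinearMap.apply_apply_of_mul_eq_one {f g : E →L[ℂ] E} (h : f * g = 1) (x : E) :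
    f (g x) = x := by
  rw [← mul_apply_eq_comp, h]; rfl

namespace LinearPMap

/-- The operator `R⁻¹ + μ` on the range of the injective operator `R`: the operator with
`R` as its resolvent at `μ`. -/
noncomputable def ofResolvent (R : E →L[ℂ] E) (hR : Function.Injective R) (μ : ℂ) :
    E →ₗ.[ℂ] E where
  domain := R.range
  toFun := (LinearEquiv.ofInjective R.toLinearMap hR).symm.toLinearMap + μ • R.range.subtype

theorem apply_mem_domain_ofResolvent {R : E →L[ℂ] E} (hR : Function.Injective R) (μ : ℂ) (x : E) :
    R x ∈ (ofResolvent R hR μ).domain :=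
  ⟨x, rfl⟩

theorem ofResolvent_apply {R : E →L[ℂ] E} (hR : Function.Injective R) (μ : ℂ) (x : E)
    (h : R x ∈ (ofResolvent R hR μ).domain) : ofResolvent R hR μ ⟨R x, h⟩ = x + μ • R x := by
  have : (LinearEquiv.ofInjective R.toLinearMap hR).symm ⟨R x, h⟩ = x := by
    rw [LinearEquiv.symm_apply_eq]; rfl
  show (LinearEquiv.ofInjective R.toLinearMap hR).symm ⟨R x, h⟩ + μ • R x = _
  rw [this]

theorem mem_graph_ofResolvent {R : E →L[ℂ] E} (hR : Function.Injective R) (μ : ℂ) (x w : E) :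
    (x, w) ∈ (ofResolvent R hR μ).graph ↔ x = R (w - μ • x) := by
  rw [mem_graph_iff]
  constructor
  · rintro ⟨⟨_, y, rfl⟩, rfl, h⟩
    simp only at h
    have h1 := ofResolvent_apply hR μ y ⟨y, rfl⟩
    have h2 : w = y + μ • R y := by rw [← h1, ← h]; rfl
    simp [h2]
  · intro h
    refine ⟨⟨x, _, h.symm⟩, rfl, ?_⟩
    have h1 := ofResolvent_apply hR μ (w - μ • x) ⟨_, rfl⟩
    simp only [← h] at h1
    simpa using h1

/-- The first resolvent identity, read as `(H - z)⁻¹ = R (1 - (z - μ) R)⁻¹` for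
`R = (H - μ)⁻¹`. -/
theorem isResolventAt_ofResolvent {R : E →L[ℂ] E} (hR : Function.Injective R) {μ z : ℂ}
    {G : E →L[ℂ] E} (h1 : (1 - (z - μ) • R) * G = 1) (h2 : G * (1 - (z - μ) • R) = 1) :
    (ofResolvent R hR μ).IsResolventAt z (R * G) := by
  constructor
  · intro x
    refine ⟨apply_mem_domain_ofResolvent hR μ (G x), ?_⟩
    have h : G x - (z - μ) • R (G x) = x := ContinuousLinearMap.apply_apply_of_mul_eq_one h1 x
    refine Eq.trans ?_ h
    have h3 := ofResolvent_apply hR μ (G x) ⟨_, rfl⟩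
    refine (congrArg (· - z • R (G x)) h3).trans ?_
    module
  · rintro ⟨_, y, rfl⟩
    have h : G (y - (z - μ) • R y) = y := ContinuousLinearMap.apply_apply_of_mul_eq_one h2 y
    have h3 := ofResolvent_apply hR μ y ⟨_, rfl⟩
    show R (G (ofResolvent R hR μ ⟨R y, _⟩ - z • R y)) = R y
    rw [h3]
    have h4 : y + μ • R y - z • R y = y - (z - μ) • R y := by module
    rw [h4, h]

end LinearPMap

variable [CompleteSpace E]

theorem ContinuousLinearMap.exists_inverse_of_le_norm_inner {f : E →L[ℂ] E} {c : ℝ} (hc : 0 < c)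
    (h : ∀ x, c * ‖x‖ ^ 2 ≤ ‖⟪f x, x⟫_ℂ‖) :
    ∃ g : E →L[ℂ] E, f * g = 1 ∧ g * f = 1 ∧ ‖g‖ ≤ c⁻¹ := by
  lift c to NNReal using hc.le
  have h' : ∀ x, ‖x‖ ^ 2 * c ≤ ‖⟪f x, x⟫_ℂ‖ := fun x => by
    rw [mul_comm]; exact h x
  obtain ⟨u, rfl⟩ := ContinuousLinearMap.isUnit_of_forall_le_norm_inner_map f (by simpa using hc) h'
  refine ⟨↑u⁻¹, u.mul_inv, u.inv_mul, ContinuousLinearMap.opNorm_le_bound _ (by positivity) ?_⟩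
  intro x
  have h2 := (ContinuousLinearMap.antilipschitz_of_forall_le_inner_map _
    (by simpa using hc) h').le_mul_dist ((↑u⁻¹ : E →L[ℂ] E) x) 0
  simpa [ContinuousLinearMap.apply_apply_of_mul_eq_one u.mul_inv x] using h2

theorem isSelfAdjoint_of_mul_eq_one {f g : E →L[ℂ] E} (hf : IsSelfAdjoint f) (hfg : f * g = 1) :
    IsSelfAdjoint g := by
  have h : star g * f = 1 := by
    have := congrArg star hfg
    rwa [star_mul, star_one, hf.star_eq] at this
  calc star g = star g * (f * g) := by rw [hfg, mul_one]
    _ = g := by rw [← mul_assoc, h, one_mul]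

theorem IsSelfAdjoint.inner_map_comm {R : E →L[ℂ] E} (hR : IsSelfAdjoint R) (x y : E) :
    ⟪R x, y⟫_ℂ = ⟪x, R y⟫_ℂ := by
  rw [← ContinuousLinearMap.adjoint_inner_right, hR.adjoint_eq]

theorem IsSelfAdjoint.dense_range {R : E →L[ℂ] E} (hR : IsSelfAdjoint R)
    (hinj : Function.Injective R) : Dense (R.range : Set E) := by
  rw [Submodule.dense_iff_topologicalClosure_eq_top, Submodule.topologicalClosure_eq_top_iff,
    ContinuousLinearMap.orthogonal_range, hR.adjoint_eq, LinearMap.ker_eq_bot]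
  exact hinj

/-- For a self-adjoint `R` the numerical range of `1 - ζ R` lies on the line `1 - ζ ℝ`, which has
distance `|Im ζ| / |ζ|` from the origin. -/
theorem IsSelfAdjoint.exists_inverse_one_sub_smul {R : E →L[ℂ] E} (hR : IsSelfAdjoint R) {ζ : ℂ}
    (hζ : ζ.im ≠ 0) :
    ∃ G : E →L[ℂ] E, (1 - ζ • R) * G = 1 ∧ G * (1 - ζ • R) = 1 ∧ ‖G‖ ≤ (|ζ.im| / ‖ζ‖)⁻¹ := by
  have hζ0 : ζ ≠ 0 := by rintro rfl; simp at hζ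
  refine ContinuousLinearMap.exists_inverse_of_le_norm_inner
    (div_pos (abs_pos.mpr hζ) (norm_pos_iff.mpr hζ0)) fun x => ?_
  obtain ⟨r, hr⟩ : ∃ r : ℝ, ⟪R x, x⟫_ℂ = r := by
    refine ⟨(⟪R x, x⟫_ℂ).re, ?_⟩
    rw [eq_comm, ← Complex.conj_eq_iff_re, inner_conj_symm, hR.inner_map_comm]
  have hx : ⟪x, x⟫_ℂ = ((‖x‖ ^ 2 : ℝ) : ℂ) := by
    rw [inner_self_eq_norm_sq_to_K]; simp
  have h1 : ⟪(1 - ζ • R) x, x⟫_ℂ = ((‖x‖ ^ 2 : ℝ) : ℂ) - starRingEnd ℂ ζ * r := by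
    rw [sub_apply, inner_sub_left, one_apply_eq_self, hx, smul_apply, inner_smul_left, hr]
  rw [h1, div_mul_eq_mul_div, div_le_iff₀ (norm_pos_iff.mpr hζ0), ← norm_mul]
  have h2 : ((((‖x‖ ^ 2 : ℝ) : ℂ) - starRingEnd ℂ ζ * r) * ζ).im = ‖x‖ ^ 2 * ζ.im := by
    simp only [Complex.mul_im, Complex.sub_re, Complex.sub_im, Complex.mul_re, Complex.ofReal_re,
      Complex.ofReal_im, Complex.conj_re, Complex.conj_im]
    ring
  calc |ζ.im| * ‖x‖ ^ 2 = |‖x‖ ^ 2 * ζ.im| := by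
        rw [abs_mul, abs_of_nonneg (by positivity : 0 ≤ ‖x‖ ^ 2), mul_comm]
    _ ≤ _ := h2 ▸ Complex.abs_im_le_norm _

namespace LinearPMap

theorem isSelfAdjoint_ofResolvent {R : E →L[ℂ] E} (hR : Function.Injective R)
    (hRsa : IsSelfAdjoint R) (μ : ℝ) : IsSelfAdjoint (ofResolvent R hR (μ : ℂ)) := by
  have hd : Dense ((ofResolvent R hR (μ : ℂ)).domain : Set E) := hRsa.dense_range hR
  have hle : ofResolvent R hR (μ : ℂ) ≤ (ofResolvent R hR (μ : ℂ)).adjoint := by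
    refine IsFormalAdjoint.le_adjoint hd ?_
    rintro ⟨_, x, rfl⟩ ⟨_, y, rfl⟩
    have hx := ofResolvent_apply hR μ x ⟨_, rfl⟩
    have hy := ofResolvent_apply hR μ y ⟨_, rfl⟩
    show ⟪ofResolvent R hR μ ⟨R x, _⟩, R y⟫_ℂ = ⟪R x, ofResolvent R hR μ ⟨R y, _⟩⟫_ℂ
    rw [hx, hy, inner_add_left, inner_add_right, inner_smul_left, inner_smul_right,
      hRsa.inner_map_comm x y, Complex.conj_ofReal]
  rw [isSelfAdjoint_def]
  refine (eq_of_le_of_domain_eq hle (le_antisymm hle.1 fun y hy => ?_)).symm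
  set w := (ofResolvent R hR (μ : ℂ)).adjoint ⟨y, hy⟩ with hw
  refine ⟨w - (μ : ℂ) • y, ext_inner_right ℂ fun x => ?_⟩
  have h := adjoint_isFormalAdjoint hd ⟨y, hy⟩ ⟨R x, apply_mem_domain_ofResolvent hR μ x⟩
  rw [← hw, ofResolvent_apply hR μ x] at h
  have h' : ⟪w, R x⟫_ℂ = ⟪y, x + (μ : ℂ) • R x⟫_ℂ := h
  show ⟪R (w - (μ : ℂ) • y), x⟫_ℂ = ⟪y, x⟫_ℂ
  rw [hRsa.inner_map_comm, inner_sub_left, h', inner_add_right, inner_smul_left, inner_smul_right,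
    Complex.conj_ofReal, add_sub_cancel_right]

theorem isSymm_of_isSelfAdjoint {T : E →ₗ.[ℂ] E} (hT : IsSelfAdjoint T) : T.IsSymm := by
  intro x y
  have h := adjoint_isFormalAdjoint hT.dense_domain
  rw [isSelfAdjoint_def.mp hT] at h
  exact h x y

/-- A self-adjoint operator bounded from below by `γ` has a bounded positive inverse of `T + lam`
for `lam > -γ`. -/
theorem exists_inverse_add {T : E →ₗ.[ℂ] E} (hT : IsSelfAdjoint T) {γ lam : ℝ}
    (hγ : ∀ x : T.domain, γ * ‖(x : E)‖ ^ 2 ≤ (⟪(x : E), T x⟫_ℂ).re) (hlam : 0 < lam + γ) :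
    ∃ R : E →L[ℂ] E, 0 ≤ R ∧ ‖R‖ ≤ (lam + γ)⁻¹ ∧
      (∀ x, ∃ h : R x ∈ T.domain, T ⟨R x, h⟩ + (lam : ℂ) • R x = x) ∧
      ∀ x : T.domain, R (T x + (lam : ℂ) • (x : E)) = x := by
  have hsymm := isSymm_of_isSelfAdjoint hT
  let L : T.domain →ₗ[ℂ] E := T.toFun + (lam : ℂ) • T.domain.subtype
  have hL : ∀ x : T.domain, L x = T x + (lam : ℂ) • (x : E) := fun _ => rfl
  have hre : ∀ x : T.domain, (lam + γ) * ‖(x : E)‖ ^ 2 ≤ (⟪(x : E), L x⟫_ℂ).re := by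
    intro x
    have h2 : ((lam : ℂ) * ⟪(x : E), (x : E)⟫_ℂ).re = lam * ‖(x : E)‖ ^ 2 := by
      rw [Complex.re_ofReal_mul]
      congr 1
      exact inner_self_eq_norm_sq (𝕜 := ℂ) (x : E)
    rw [hL, inner_add_right, inner_smul_right, Complex.add_re, h2]
    linarith [hγ x]
  have hbd : ∀ x : T.domain, ‖(x : E)‖ ≤ (lam + γ)⁻¹ * ‖L x‖ := by
    intro x
    rw [inv_mul_eq_div, le_div_iff₀ hlam]
    rcases eq_or_ne (‖(x : E)‖) 0 with h0 | h0
    · rw [h0]; simp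
    · have h1 : (lam + γ) * ‖(x : E)‖ ^ 2 ≤ ‖(x : E)‖ * ‖L x‖ :=
        (hre x).trans ((Complex.re_le_norm _).trans (norm_inner_le_norm _ _))
      have h2 : 0 < ‖(x : E)‖ := lt_of_le_of_ne (norm_nonneg _) h0.symm
      nlinarith
  have hinj : Function.Injective L := by
    rw [← LinearMap.ker_eq_bot, LinearMap.ker_eq_bot']
    intro x hx
    have := hbd x
    rw [hx, norm_zero, mul_zero] at this
    exact Subtype.ext (norm_le_zero_iff.mp this)
  have hclosed : _root_.IsClosed (L.range : Set E) := by
    refine IsSeqClosed.isClosed fun y a hy ha => ?_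
    choose x hx using hy
    have hc : CauchySeq fun n => (x n : E) := by
      have hya := ha.cauchySeq
      rw [Metric.cauchySeq_iff] at hya ⊢
      intro ε hε
      obtain ⟨N, hN⟩ := hya ((lam + γ) * ε) (by positivity)
      refine ⟨N, fun m hm n hn => ?_⟩
      have h1 := hN m hm n hn
      have h2 := hbd (x m - x n)
      rw [_root_.map_sub, hx, hx, inv_mul_eq_div, le_div_iff₀ hlam] at h2
      rw [dist_eq_norm] at h1 ⊢
      have h3 : ‖((x m - x n : T.domain) : E)‖ = ‖(x m : E) - x n‖ := rfl
      rw [h3] at h2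
      nlinarith
    obtain ⟨b, hb⟩ := cauchySeq_tendsto_of_complete hc
    have hg : (b, a - (lam : ℂ) • b) ∈ T.graph := by
      refine hT.isClosed.mem_of_tendsto (hb.prodMk_nhds (ha.sub (hb.const_smul (lam : ℂ))))
        (Eventually.of_forall fun n => ?_)
      rw [SetLike.mem_coe, mem_graph_iff]
      exact ⟨x n, rfl, by rw [← hx n, hL]; simp⟩
    rw [mem_graph_iff] at hg
    obtain ⟨b', hb', hTb⟩ := hg
    refine ⟨b', ?_⟩
    rw [hL, hTb, hb']
    simp
  have hsurj : L.range = ⊤ := by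
    have : CompleteSpace L.range := hclosed.completeSpace_coe
    rw [← Submodule.orthogonal_eq_bot_iff, Submodule.eq_bot_iff]
    intro y hy
    have h1 : ∀ x : T.domain, ⟪-(lam : ℂ) • y, (x : E)⟫_ℂ = ⟪y, T x⟫_ℂ := by
      intro x
      have h2 := (Submodule.mem_orthogonal' _ _).mp hy (L x) ⟨x, rfl⟩
      rw [hL, inner_add_right, inner_smul_right] at h2
      rw [inner_smul_left, _root_.map_neg, Complex.conj_ofReal]
      linear_combination -h2
    have hmem : y ∈ T.adjoint.domain := mem_adjoint_domain_of_exists _ ⟨_, h1⟩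
    have heq : T.adjoint ⟨y, hmem⟩ = -(lam : ℂ) • y := adjoint_apply_eq hT.dense_domain _ h1
    have hg : (y, -(lam : ℂ) • y) ∈ T.adjoint.graph := by
      rw [mem_graph_iff]; exact ⟨⟨y, hmem⟩, rfl, heq⟩
    rw [isSelfAdjoint_def.mp hT, mem_graph_iff] at hg
    obtain ⟨y', hy', hTy⟩ := hg
    have hLy : L y' = 0 := by rw [hL, hTy, hy']; simp
    have hy0 : (y' : E) = y := hy'
    rw [← hy0, (map_eq_zero_iff L hinj).mp hLy]
    rfl
  let e := LinearEquiv.ofBijective L ⟨hinj, LinearMap.range_eq_top.mp hsurj⟩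
  have he : ∀ x, L (e.symm x) = x := fun x => e.apply_symm_apply x
  let R : E →L[ℂ] E := (T.domain.subtype.comp e.symm.toLinearMap).mkContinuous (lam + γ)⁻¹
    fun x => by
      have := hbd (e.symm x)
      rwa [he] at this
  have hR : ∀ x, R x = (e.symm x : T.domain) := fun _ => rfl
  refine ⟨R, ?_, LinearMap.mkContinuous_norm_le _ (by positivity) _, ?_, ?_⟩
  · rw [ContinuousLinearMap.nonneg_iff_isPositive, ContinuousLinearMap.isPositive_def]
    refine ⟨fun x y => ?_, fun x => ?_⟩
    · show ⟪((e.symm x : T.domain) : E), y⟫_ℂ = ⟪x, ((e.symm y : T.domain) : E)⟫_ℂ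
      conv_lhs => rw [← he y, hL]
      conv_rhs => rw [← he x, hL]
      rw [inner_add_right, inner_add_left, inner_smul_right, inner_smul_left, hsymm,
        Complex.conj_ofReal]
    · have h1 := hre (e.symm x)
      rw [he] at h1
      rw [ContinuousLinearMap.reApplyInnerSelf_apply, hR]
      exact (mul_nonneg hlam.le (sq_nonneg _)).trans h1
  · exact fun x => ⟨(e.symm x).2, he x⟩
  · intro x
    rw [hR, ← hL]
    exact congrArg _ (e.symm_apply_apply x)

end LinearPMap

end Resolvent

/-! ### The form of a semibounded operator through the square root of its resolvent -/

section Form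

variable {E : Type*} [NormedAddCommGroup E] [InnerProductSpace ℂ E] [CompleteSpace E]

namespace LinearPMap

/-- `Q = (T + lam)^(-1/2)`: a self-adjoint operator with `Q ^ 2 = (T + lam)⁻¹`. Positivity of `Q`
is never needed. -/
structure IsInvSqrt (T : E →ₗ.[ℂ] E) (lam : ℝ) (Q : E →L[ℂ] E) : Prop where
  isSelfAdjoint : IsSelfAdjoint Q
  add_apply_sq : ∀ x, ∃ h : Q (Q x) ∈ T.domain, T ⟨Q (Q x), h⟩ + (lam : ℂ) • Q (Q x) = x
  sq_apply_add : ∀ x : T.domain, Q (Q (T x + (lam : ℂ) • (x : E))) = x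

theorem exists_isInvSqrt {T : E →ₗ.[ℂ] E} (hT : IsSelfAdjoint T) {γ lam : ℝ}
    (hγ : ∀ x : T.domain, γ * ‖(x : E)‖ ^ 2 ≤ (⟪(x : E), T x⟫_ℂ).re) (hlam : 0 < lam + γ) :
    ∃ Q : E →L[ℂ] E, T.IsInvSqrt lam Q ∧ ∀ x, ‖Q x‖ ^ 2 ≤ (lam + γ)⁻¹ * ‖x‖ ^ 2 := by
  obtain ⟨R, hR, hRn, h1, h2⟩ := exists_inverse_add hT hγ hlam
  have hsq : ∀ x, CFC.sqrt R (CFC.sqrt R x) = R x := fun x => by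
    rw [← mul_apply_eq_comp, CFC.sqrt_mul_sqrt_self R hR]
  have hsa : IsSelfAdjoint (CFC.sqrt R) := (CFC.sqrt_nonneg R).isSelfAdjoint
  refine ⟨CFC.sqrt R, ⟨hsa, fun x => ?_, fun x => ?_⟩, fun x => ?_⟩
  · simp only [hsq]; exact h1 x
  · rw [hsq]; exact h2 x
  · have h3 : ‖CFC.sqrt R x‖ ^ 2 = (⟪x, R x⟫_ℂ).re := by
      rw [← hsq, ← hsa.inner_map_comm]
      exact (inner_self_eq_norm_sq (𝕜 := ℂ) _).symm
    rw [h3]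
    calc (⟪x, R x⟫_ℂ).re ≤ ‖x‖ * ‖R x‖ := (Complex.re_le_norm _).trans (norm_inner_le_norm _ _)
      _ ≤ ‖x‖ * ((lam + γ)⁻¹ * ‖x‖) := by
        gcongr
        exact (R.le_opNorm x).trans (by gcongr)
      _ = _ := by ring

namespace IsInvSqrt

variable {T : E →ₗ.[ℂ] E} {lam : ℝ} {Q : E →L[ℂ] E}

theorem injective (hQ : T.IsInvSqrt lam Q) : Function.Injective Q := by
  refine (injective_iff_map_eq_zero Q).mpr fun x hx => ?_
  obtain ⟨h, h'⟩ := hQ.add_apply_sq x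
  have h0 : (⟨Q (Q x), h⟩ : T.domain) = 0 := by
    apply Subtype.ext
    show Q (Q x) = 0
    rw [hx, _root_.map_zero]
  rw [h0, LinearPMap.map_zero, hx, _root_.map_zero, smul_zero, add_zero] at h'
  exact h'.symm

theorem inner_apply (hQ : T.IsInvSqrt lam Q) (x y : T.domain) :
    ⟪(x : E), T y⟫_ℂ = ⟪Q (T x + (lam : ℂ) • (x : E)), Q (T y + (lam : ℂ) • (y : E))⟫_ℂ -
      lam * ⟪(x : E), (y : E)⟫_ℂ := by
  rw [← hQ.isSelfAdjoint.inner_map_comm, hQ.sq_apply_add, inner_add_right, inner_smul_right,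
    add_sub_cancel_right]

/-- Approximating sequences for the form of `T` are the images under `Q` of convergent ones. -/
theorem exists_tendsto_of_formApprox (hQ : T.IsInvSqrt lam Q) {u : ℕ → T.domain} {ψ : E}
    (hu : T.FormApprox u ψ) :
    ∃ g, Q g = ψ ∧ Tendsto (fun n => Q (T (u n) + (lam : ℂ) • (u n : E))) atTop (𝓝 g) := by
  let w : ℕ → E := fun n => Q (T (u n) + (lam : ℂ) • (u n : E))
  have hw : ∀ p : ℕ × ℕ, Q (T (u p.1 - u p.2) + (lam : ℂ) • ((u p.1 - u p.2 : T.domain) : E)) =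
      w p.1 - w p.2 := by
    intro p
    rw [← _root_.map_sub Q]
    congr 1
    rw [LinearPMap.map_sub, Submodule.coe_sub]
    module
  have hz : Tendsto (fun p : ℕ × ℕ => ((u p.1 - u p.2 : T.domain) : E)) atTop (𝓝 0) := by
    have ha : Tendsto (fun p : ℕ × ℕ => (u p.1 : E)) atTop (𝓝 ψ) := by
      rw [← prod_atTop_atTop_eq]; exact hu.1.comp tendsto_fst
    have hb : Tendsto (fun p : ℕ × ℕ => (u p.2 : E)) atTop (𝓝 ψ) := by
      rw [← prod_atTop_atTop_eq]; exact hu.1.comp tendsto_snd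
    simpa using ha.sub hb
  have hc : CauchySeq w := by
    rw [cauchySeq_iff_tendsto_dist_atTop_0]
    have h := (hu.2.add ((hz.inner (𝕜 := ℂ) hz).const_mul (lam : ℂ))).norm.sqrt
    simp only [inner_zero_left, mul_zero, add_zero, norm_zero, Real.sqrt_zero] at h
    refine h.congr fun p => ?_
    rw [hQ.inner_apply, hw, sub_add_cancel, inner_self_eq_norm_sq_to_K, norm_pow, dist_eq_norm]
    simp
  obtain ⟨g, hg⟩ := cauchySeq_tendsto_of_complete hc
  refine ⟨g, tendsto_nhds_unique ((Q.continuous.tendsto g).comp hg) (hu.1.congr fun n => ?_), hg⟩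
  exact (hQ.sq_apply_add (u n)).symm

theorem exists_formApprox (hQ : T.IsInvSqrt lam Q) (g : E) :
    ∃ u, T.FormApprox u (Q g) ∧
      Tendsto (fun n => Q (T (u n) + (lam : ℂ) • (u n : E))) atTop (𝓝 g) := by
  obtain ⟨w, hw, hwg⟩ := mem_closure_iff_seq_limit.mp
    (hQ.isSelfAdjoint.dense_range hQ.injective g)
  choose y hy using hw
  have hy' : ∀ n, Q (y n) = w n := hy
  choose h hadd using fun n => hQ.add_apply_sq (y n)
  let u : ℕ → T.domain := fun n => ⟨Q (Q (y n)), h n⟩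
  have hu : ∀ n, T (u n) + (lam : ℂ) • (u n : E) = y n := hadd
  have huw : ∀ n, (u n : E) = Q (w n) := fun n => by rw [← hy']
  have hu1 : Tendsto (fun n => (u n : E)) atTop (𝓝 (Q g)) := by
    simp only [huw]
    exact (Q.continuous.tendsto g).comp hwg
  refine ⟨u, ⟨hu1, ?_⟩, by simpa only [hu, hy'] using hwg⟩
  have hp : Tendsto (fun p : ℕ × ℕ => w p.1 - w p.2) atTop (𝓝 0) := by
    have ha : Tendsto (fun p : ℕ × ℕ => w p.1) atTop (𝓝 g) := by
      rw [← prod_atTop_atTop_eq]; exact hwg.comp tendsto_fst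
    have hb : Tendsto (fun p : ℕ × ℕ => w p.2) atTop (𝓝 g) := by
      rw [← prod_atTop_atTop_eq]; exact hwg.comp tendsto_snd
    simpa using ha.sub hb
  have hq := (Q.continuous.tendsto 0).comp hp
  have hlim := (hp.inner (𝕜 := ℂ) hp).sub ((hq.inner (𝕜 := ℂ) hq).const_mul (lam : ℂ))
  simp only [_root_.map_zero, inner_zero_left, mul_zero, sub_zero] at hlim
  refine hlim.congr fun p => ?_
  have h3 : Q (T (u p.1 - u p.2) + (lam : ℂ) • ((u p.1 - u p.2 : T.domain) : E)) =
      w p.1 - w p.2 := by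
    rw [← hy', ← hy', ← hu, ← hu, ← _root_.map_sub Q]
    congr 1
    rw [LinearPMap.map_sub, Submodule.coe_sub]
    module
  rw [hQ.inner_apply, h3, Submodule.coe_sub, huw, huw, ← _root_.map_sub Q]
  rfl

theorem mem_formDomain_iff (hQ : T.IsInvSqrt lam Q) {ψ : E} :
    ψ ∈ T.formDomain ↔ ∃ g, Q g = ψ := by
  constructor
  · rintro ⟨u, hu⟩
    obtain ⟨g, hg, -⟩ := hQ.exists_tendsto_of_formApprox hu
    exact ⟨g, hg⟩
  · rintro ⟨g, rfl⟩
    obtain ⟨u, hu, -⟩ := hQ.exists_formApprox g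
    exact ⟨u, hu⟩

theorem form_apply (hQ : T.IsInvSqrt lam Q) (hT : T.IsSymm) (hb : T.BddBelow) (f g : E) :
    T.form (Q f) (Q g) = ⟪f, g⟫_ℂ - lam * ⟪Q f, Q g⟫_ℂ := by
  obtain ⟨u, hu, hu'⟩ := hQ.exists_formApprox f
  obtain ⟨v, hv, hv'⟩ := hQ.exists_formApprox g
  refine tendsto_nhds_unique (tendsto_form hT hb hu hv) ?_
  simp only [hQ.inner_apply]
  exact (hu'.inner hv').sub ((hu.1.inner hv.1).const_mul _)

/-- A form bounded `A` becomes the bounded operator `A (T + lam)^(-1/2)`. -/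
theorem exists_comp_eq (hQ : T.IsInvSqrt lam Q) (hT : T.IsSymm) (hb : T.BddBelow)
    (hlam : 0 ≤ lam) {A : E →ₗ.[ℂ] E} {a b : ℝ} (ha : 0 ≤ a) (hb0 : 0 ≤ b)
    (hA : A.IsFormBoundedWith T a b) :
    ∃ C : E →L[ℂ] E, (∀ f, ∃ h : Q f ∈ A.domain, A ⟨Q f, h⟩ = C f) ∧
      ∀ f, ‖C f‖ ^ 2 ≤ a * ‖f‖ ^ 2 + b * ‖Q f‖ ^ 2 := by
  have hmem : ∀ f, Q f ∈ T.formDomain := fun f => hQ.mem_formDomain_iff.mpr ⟨f, rfl⟩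
  have hre : ∀ f, (T.form (Q f) (Q f)).re ≤ ‖f‖ ^ 2 := by
    intro f
    rw [hQ.form_apply hT hb, Complex.sub_re, Complex.re_ofReal_mul]
    have h1 : (⟪f, f⟫_ℂ).re = ‖f‖ ^ 2 := inner_self_eq_norm_sq (𝕜 := ℂ) f
    have h2 : (⟪Q f, Q f⟫_ℂ).re = ‖Q f‖ ^ 2 := inner_self_eq_norm_sq (𝕜 := ℂ) (Q f)
    rw [h1, h2]
    have : 0 ≤ lam * ‖Q f‖ ^ 2 := by positivity
    linarith
  choose hd hbound using fun f => hA (Q f) (hmem f)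
  have hbound' : ∀ f, ‖A ⟨Q f, hd f⟩‖ ^ 2 ≤ a * ‖f‖ ^ 2 + b * ‖Q f‖ ^ 2 := by
    intro f
    refine (hbound f).trans ?_
    gcongr
    exact hre f
  let C₀ : E →ₗ[ℂ] E := A.toFun.comp (Q.toLinearMap.codRestrict A.domain hd)
  have hC₀ : ∀ f, C₀ f = A ⟨Q f, hd f⟩ := fun _ => rfl
  let C : E →L[ℂ] E := C₀.mkContinuous (Real.sqrt (a + b * ‖Q‖ ^ 2)) fun f => by
    rw [← Real.sqrt_sq (norm_nonneg f), ← Real.sqrt_mul (by positivity)]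
    refine Real.le_sqrt_of_sq_le ((hbound' f).trans ?_)
    have : ‖Q f‖ ^ 2 ≤ (‖Q‖ * ‖f‖) ^ 2 := by gcongr; exact Q.le_opNorm f
    nlinarith
  exact ⟨C, fun f => ⟨hd f, rfl⟩, hbound'⟩

/-- `Q M⁻¹ Q` with `M = 1 + ∑ Cⱼ* Bⱼ Cⱼ` is the inverse of the form sum shifted by `lam`. -/
theorem isFormSum_ofResolvent (hQ : T.IsInvSqrt lam Q) (hT : T.IsSymm) (hb : T.BddBelow) {n : ℕ}
    {A : Fin n → E →ₗ.[ℂ] E} {B C : Fin n → E →L[ℂ] E}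
    (hC : ∀ j f, ∃ h : Q f ∈ (A j).domain, A j ⟨Q f, h⟩ = C j f) {N : E →L[ℂ] E}
    (h1 : (1 + ∑ j, (C j).adjoint * (B j * C j)) * N = 1)
    (h2 : N * (1 + ∑ j, (C j).adjoint * (B j * C j)) = 1)
    (hinj : Function.Injective (Q * N * Q)) :
    T.IsFormSum A B (ofResolvent (Q * N * Q) hinj ((-lam : ℝ) : ℂ)) := by
  choose hd hAC using hC
  set M : E →L[ℂ] E := 1 + ∑ j, (C j).adjoint * (B j * C j) with hM
  have hMin : ∀ f g, ⟪f, M g⟫_ℂ = ⟪f, g⟫_ℂ + ∑ j, ⟪C j f, B j (C j g)⟫_ℂ := by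
    intro f g
    rw [hM, _root_.add_apply, inner_add_right, _root_.sum_apply, inner_sum, one_apply_eq_self]
    congr 1
    refine Finset.sum_congr rfl fun j _ => ?_
    rw [mul_apply_eq_comp, ContinuousLinearMap.adjoint_inner_right]
    rfl
  have key : ∀ g w, (∀ f, T.form (Q f) (Q g) + ∑ j, ⟪C j f, B j (C j g)⟫_ℂ = ⟪Q f, w⟫_ℂ) ↔
      M g = Q (w + (lam : ℂ) • Q g) := by
    intro g w
    have h3 : ∀ f, T.form (Q f) (Q g) + ∑ j, ⟪C j f, B j (C j g)⟫_ℂ - ⟪Q f, w⟫_ℂ =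
        ⟪f, M g⟫_ℂ - ⟪f, Q (w + (lam : ℂ) • Q g)⟫_ℂ := by
      intro f
      rw [hQ.form_apply hT hb, hMin, ← hQ.isSelfAdjoint.inner_map_comm f (w + _), inner_add_right,
        inner_smul_right]
      ring
    constructor
    · intro h
      refine ext_inner_left ℂ fun f => ?_
      rw [← sub_eq_zero, ← h3, h, sub_self]
    · intro h f
      rw [← sub_eq_zero, h3, h, sub_self]
  intro ψ w
  rw [mem_graph_ofResolvent, hQ.mem_formDomain_iff]
  have hw : w - ((-lam : ℝ) : ℂ) • ψ = w + (lam : ℂ) • ψ := by push_cast; module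
  rw [hw]
  constructor
  · intro h
    obtain ⟨g, hgdef⟩ : ∃ g, g = N (Q (w + (lam : ℂ) • ψ)) := ⟨_, rfl⟩
    have hg : Q g = ψ := hgdef ▸ h.symm
    refine ⟨⟨g, hg⟩, fun j => hg ▸ hd j g, fun φ hφ hφ' => ?_⟩
    obtain ⟨f, rfl⟩ := hQ.mem_formDomain_iff.mp hφ
    have h4 := (key g w).mpr (by
      rw [hg, hgdef]; exact ContinuousLinearMap.apply_apply_of_mul_eq_one h1 _) f
    subst hg
    simpa only [hAC] using h4
  · rintro ⟨⟨g, rfl⟩, hψ, h⟩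
    have h4 := (key g w).mp fun f => by
      have h5 := h (Q f) (hQ.mem_formDomain_iff.mpr ⟨f, rfl⟩) fun j => hd j f
      simpa only [hAC] using h5
    show Q g = Q (N (Q (w + (lam : ℂ) • Q g)))
    rw [← h4, ContinuousLinearMap.apply_apply_of_mul_eq_one h2]

end IsInvSqrt

end LinearPMap

end Form

/-! ### The perturbed resolvents -/

section Perturbation

variable {E : Type*} [NormedAddCommGroup E] [InnerProductSpace ℂ E]

/-- Form bounds `a j` of all `A j`, which sum up to less than one if those with `S j ≥ 0` are
left out: `α j` bounds `a j` for the other ones. -/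
theorem exists_formBounds {H₀ : E →ₗ.[ℂ] E} {n : ℕ} {A : Fin n → E →ₗ.[ℂ] E}
    {S : Fin n → E →L[ℂ] E}
    (hA_init : ∀ j : Fin n, (j : ℕ) + 1 < n →
      ((A j).IsFormBoundedLTOne H₀ ∧ (S j).IsPositive) ∨ (A j).IsInfFormBounded H₀)
    (hA_last : ∀ j : Fin n, (j : ℕ) + 1 = n → (A j).IsFormBoundedLTOne H₀) :
    ∃ a b α : Fin n → ℝ, (∀ j, 0 ≤ a j ∧ 0 ≤ b j ∧ 0 ≤ α j ∧
      (A j).IsFormBoundedWith H₀ (a j) (b j) ∧ ((S j).IsPositive ∨ a j ≤ α j)) ∧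
      ∑ j, α j < 1 := by
  rcases n with - | m
  · exact ⟨0, 0, 0, fun j => j.elim0, by simp⟩
  obtain ⟨a₀, b₀, ha₀, ha₁, hb₀, hlast⟩ := hA_last (Fin.last m) (by simp)
  -- the first `m` weights share less than half of `1 - a₀`
  have hδ : 0 < (1 - a₀) / (2 * (m + 1)) := div_pos (by linarith) (by positivity)
  have hinit : ∀ j : Fin m, ∃ a b : ℝ, 0 ≤ a ∧ 0 ≤ b ∧
      (A j.castSucc).IsFormBoundedWith H₀ a b ∧
      ((S j.castSucc).IsPositive ∨ a ≤ (1 - a₀) / (2 * (m + 1))) := by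
    intro j
    rcases hA_init j.castSucc (by simp) with ⟨⟨a, b, h0, -, hb, h⟩, hS⟩ | h
    · exact ⟨a, b, h0, hb, h, Or.inl hS⟩
    · obtain ⟨b, hb, h⟩ := h _ hδ
      exact ⟨_, b, hδ.le, hb, h, Or.inr le_rfl⟩
  choose a b h0 hb h hS using hinit
  refine ⟨Fin.snoc a a₀, Fin.snoc b b₀, Fin.snoc (fun _ => (1 - a₀) / (2 * (m + 1))) a₀,
    fun j => ?_, ?_⟩
  · refine Fin.lastCases ?_ (fun j => ?_) j
    · simpa using ⟨ha₀, hb₀, ha₀, hlast⟩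
    · simpa using ⟨h0 j, hb j, hδ.le, h j, hS j⟩
  · rw [Fin.sum_univ_castSucc]
    simp only [Fin.snoc_castSucc, Fin.snoc_last, Finset.sum_const, Finset.card_univ,
      Fintype.card_fin, nsmul_eq_mul]
    have h1 : (m : ℝ) * ((1 - a₀) / (2 * (m + 1))) + ((1 - a₀) / (2 * (m + 1))) =
      (1 - a₀) / 2 := by field_simp
    linarith

variable [CompleteSpace E]

/-- If `Cⱼ* Bⱼ Cⱼ ≥ -β j` with `∑ β j < 1`, then `1 + ∑ Cⱼ* Bⱼ Cⱼ` has a bounded inverse, with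
the bound coming from the lower bound `1 - ∑ β j` of its quadratic form. -/
theorem exists_inverse_one_add_sum {n : ℕ} {B C : Fin n → E →L[ℂ] E} {β : Fin n → ℝ}
    (hβ : ∑ j, β j < 1) (hBC : ∀ j f, -(β j * ‖f‖ ^ 2) ≤ (⟪B j (C j f), C j f⟫_ℂ).re) :
    ∃ N : E →L[ℂ] E, (1 + ∑ j, (C j).adjoint * (B j * C j)) * N = 1 ∧
      N * (1 + ∑ j, (C j).adjoint * (B j * C j)) = 1 ∧ ‖N‖ ≤ (1 - ∑ j, β j)⁻¹ := by
  refine ContinuousLinearMap.exists_inverse_of_le_norm_inner (by linarith) fun f => ?_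
  refine le_trans ?_ (Complex.re_le_norm _)
  have h1 : (⟪f, f⟫_ℂ).re = ‖f‖ ^ 2 := inner_self_eq_norm_sq (𝕜 := ℂ) f
  rw [add_apply, inner_add_left, sum_apply, sum_inner, one_apply_eq_self, Complex.add_re, h1,
    Complex.re_sum]
  have h2 : ∀ j, (⟪((C j).adjoint * (B j * C j)) f, f⟫_ℂ).re = (⟪B j (C j f), C j f⟫_ℂ).re := by
    intro j
    rw [mul_apply_eq_comp, ContinuousLinearMap.adjoint_inner_left]
    rfl
  simp only [h2]
  have h3 := Finset.sum_le_sum fun j (_ : j ∈ Finset.univ) => hBC j f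
  rw [Finset.sum_neg_distrib, ← Finset.sum_mul] at h3
  linarith

/-- From `M⁻¹ = 1 - M⁻¹ (M - 1)` the operators `Cⱼ M⁻¹ Q` inherit the Hilbert–Schmidt property of
the `Cₖ Q`, with a bound that depends only on `‖Cₖ‖` and `‖M⁻¹‖`. -/
theorem hilbertSchmidtSq_mul_inverse_le {n : ℕ} {ι : Type*} (b : HilbertBasis ι ℂ E)
    {B C : Fin n → E →L[ℂ] E} {N Q : E →L[ℂ] E} {c d : ℝ}
    (hN : N * (1 + ∑ j, (C j).adjoint * (B j * C j)) = 1) (hNc : ‖N‖ ≤ c)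
    (hB : ∀ j, ‖B j‖ ≤ 1) (hC : ∀ j, ‖C j‖ ≤ d) (j : Fin n) :
    hilbertSchmidtSq b (C j * N * Q) ≤
      ENNReal.ofReal ((1 + d * c * d) ^ 2 * n) * ∑ k, hilbertSchmidtSq b (C k * Q) := by
  have hd : 0 ≤ d := (norm_nonneg _).trans (hC j)
  have hc : 0 ≤ c := (norm_nonneg _).trans hNc
  refine (hilbertSchmidtSq_le_sum b (c := 1 + d * c * d) _ (fun k => C k * Q)
    fun x => ?_).trans_eq (by rw [Fintype.card_fin])
  have h1 : N (Q x) = Q x - N (∑ k, (C k).adjoint (B k (C k (Q x)))) := by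
    have h := ContinuousLinearMap.apply_apply_of_mul_eq_one hN (Q x)
    rw [add_apply, sum_apply, one_apply_eq_self, map_add] at h
    rw [eq_sub_iff_add_eq]
    exact h
  have h2 : ∀ k, ‖(C k).adjoint (B k (C k (Q x)))‖ ≤ d * ‖C k (Q x)‖ := by
    intro k
    refine ((C k).adjoint.le_opNorm _).trans ?_
    rw [LinearIsometryEquiv.norm_map ContinuousLinearMap.adjoint]
    gcongr
    · exact hC k
    · exact ((B k).le_opNorm _).trans (mul_le_of_le_one_left (norm_nonneg _) (hB k))
  have h3 : ‖C j (N (∑ k, (C k).adjoint (B k (C k (Q x)))))‖ ≤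
      d * (c * ∑ k, d * ‖C k (Q x)‖) := by
    refine ((C j).le_opNorm _).trans ?_
    gcongr
    · exact hC j
    refine (N.le_opNorm _).trans ?_
    gcongr
    exact (norm_sum_le _ _).trans (Finset.sum_le_sum fun k _ => h2 k)
  have h4 : ‖C j (Q x)‖ ≤ ∑ k, ‖C k (Q x)‖ :=
    Finset.single_le_sum (f := fun k => ‖C k (Q x)‖) (fun _ _ => norm_nonneg _)
      (Finset.mem_univ j)
  rw [← Finset.mul_sum] at h3
  calc ‖(C j * N * Q) x‖ = ‖C j (Q x) - C j (N (∑ k, (C k).adjoint (B k (C k (Q x)))))‖ := by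
        rw [← map_sub, ← h1]; rfl
    _ ≤ ‖C j (Q x)‖ + ‖C j (N (∑ k, (C k).adjoint (B k (C k (Q x)))))‖ := norm_sub_le _ _
    _ ≤ (1 + d * c * d) * ∑ k, ‖C k (Q x)‖ := by linarith
    _ = _ := rfl

/-- The second resolvent identity in factorized form, transported by the factors
`G = (1 - ζ R)⁻¹` to an arbitrary point of the resolvent sets. -/
theorem resolvent_sub_eq_sum {n : ℕ} {B B' C : Fin n → E →L[ℂ] E} {N N' Q G G' : E →L[ℂ] E}
    {ζ : ℂ} (hQ : IsSelfAdjoint Q) (hN' : IsSelfAdjoint N')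
    (h1 : (1 + ∑ j, (C j).adjoint * (B j * C j)) * N = 1)
    (h2 : N' * (1 + ∑ j, (C j).adjoint * (B' j * C j)) = 1)
    (hG : (1 - ζ • (Q * N * Q)) * G = 1)
    (hG1 : (1 - ζ • (Q * N' * Q)) * G' = 1) (hG2 : G' * (1 - ζ • (Q * N' * Q)) = 1) :
    Q * N' * Q * G' - Q * N * Q * G =
      ∑ j, (C j * N' * Q * star G').adjoint * ((B j - B' j) * (C j * N * Q * G)) := by
  have hcomm : Q * N' * Q * G' = G' * (Q * N' * Q) := by
    have h : (1 - ζ • (Q * N' * Q)) * (Q * N' * Q) = (Q * N' * Q) * (1 - ζ • (Q * N' * Q)) := by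
      simp only [sub_mul, mul_sub, one_mul, mul_one, smul_mul_assoc, mul_smul_comm]
    calc Q * N' * Q * G' = (G' * (1 - ζ • (Q * N' * Q))) * (Q * N' * Q) * G' := by
          rw [hG2, one_mul]
      _ = G' * ((1 - ζ • (Q * N' * Q)) * (Q * N' * Q)) * G' := by simp only [mul_assoc]
      _ = G' * (Q * N' * Q) * ((1 - ζ • (Q * N' * Q)) * G') := by rw [h]; simp only [mul_assoc]
      _ = _ := by rw [hG1, mul_one]
  have hR : Q * N' * Q * G' - Q * N * Q * G = G' * (Q * N' * Q - Q * N * Q) * G := by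
    calc Q * N' * Q * G' - Q * N * Q * G
        = G' * (Q * N' * Q) * ((1 - ζ • (Q * N * Q)) * G) -
            (G' * (1 - ζ • (Q * N' * Q))) * (Q * N * Q * G) := by
          rw [hG, hG2, mul_one, one_mul, hcomm]
      _ = _ := by
          simp only [sub_mul, mul_sub, one_mul, mul_one, smul_mul_assoc, mul_smul_comm, mul_assoc]
          abel
  have hNN : N' - N = ∑ j, N' * (C j).adjoint * ((B j - B' j) * (C j * N)) := by
    calc N' - N = N' * ((1 + ∑ j, (C j).adjoint * (B j * C j)) * N) -
          (N' * (1 + ∑ j, (C j).adjoint * (B' j * C j))) * N := by rw [h1, h2, mul_one, one_mul]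
      _ = N' * (∑ j, (C j).adjoint * (B j * C j) - ∑ j, (C j).adjoint * (B' j * C j)) * N := by
          simp only [mul_assoc, ← mul_sub, ← sub_mul]
          congr 2
          abel
      _ = _ := by
          rw [← Finset.sum_sub_distrib, Finset.mul_sum, Finset.sum_mul]
          refine Finset.sum_congr rfl fun j _ => ?_
          simp only [mul_assoc, mul_sub, sub_mul]
  have hQQ : Q * N' * Q - Q * N * Q = Q * (N' - N) * Q := by
    simp only [mul_sub, sub_mul]
  rw [hR, hQQ, hNN, Finset.mul_sum, Finset.sum_mul, Finset.mul_sum, Finset.sum_mul]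
  refine Finset.sum_congr rfl fun j _ => ?_
  rw [← ContinuousLinearMap.star_eq_adjoint, ← ContinuousLinearMap.star_eq_adjoint]
  simp only [star_mul, star_star, hQ.star_eq, hN'.star_eq, mul_assoc]

/-- If `A` times one resolvent is Hilbert–Schmidt, then so is `A Q ^ 2 = A (T + lam)⁻¹`. -/
theorem LinearPMap.IsInvSqrt.hilbertSchmidtSq_comp_lt_top {T A : E →ₗ.[ℂ] E} {lam : ℝ}
    {Q C : E →L[ℂ] E} (hQ : T.IsInvSqrt lam Q) (hC : ∀ f, ∃ h : Q f ∈ A.domain, A ⟨Q f, h⟩ = C f)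
    {z : ℂ} {R F : E →L[ℂ] E} (hR : T.IsResolventAt z R)
    (hF : ∀ x, ∃ h : R x ∈ A.domain, A ⟨R x, h⟩ = F x) (hFHS : IsHilbertSchmidt F)
    {ι : Type*} (b : HilbertBasis ι ℂ E) : hilbertSchmidtSq b (C * Q) < ∞ := by
  have h : C * Q = F * (1 - (lam + z) • (Q * Q)) := by
    ext x
    obtain ⟨h1, hA1⟩ := hC (Q x)
    obtain ⟨h2, hA2⟩ := hF (x - (lam + z) • Q (Q x))
    obtain ⟨h3, hT⟩ := hQ.add_apply_sq x
    have h4 : R (x - (lam + z) • Q (Q x)) = Q (Q x) := by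
      have h5 := hR.2 ⟨Q (Q x), h3⟩
      have h6 : T ⟨Q (Q x), h3⟩ - z • Q (Q x) = x - (lam + z) • Q (Q x) := by
        rw [eq_sub_of_add_eq hT]; module
      rwa [h6] at h5
    show C (Q x) = F (x - (lam + z) • Q (Q x))
    rw [← hA1, ← hA2]
    congr 2
    exact h4.symm
  rw [h]
  exact (hilbertSchmidtSq_mul_right_le b _ _).trans_lt
    (ENNReal.mul_lt_top ENNReal.ofReal_lt_top (hFHS.hilbertSchmidtSq_lt_top b))

/-- Trace norm continuity of `R(t) = Q N(t) Q G(t)`, where `N(t)` is the inverse of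
`1 + ∑ Cⱼ* Bⱼ(t) Cⱼ`, for a strongly continuous `B`. In the factorization of `R(s) - R(t)` the
left factors are bounded in Hilbert–Schmidt norm, and the right factors tend to zero in it. -/
theorem traceNorm_sub_lt_top_and_tendsto {P : Type*} [TopologicalSpace P] {n : ℕ}
    {B : P → Fin n → E →L[ℂ] E} {C : Fin n → E →L[ℂ] E} {N G : P → E →L[ℂ] E} {Q : E →L[ℂ] E}
    {ζ : ℂ} {c g : ℝ} (hQ : IsSelfAdjoint Q) (hN : ∀ t, IsSelfAdjoint (N t))
    (hB : ∀ t j, ‖B t j‖ ≤ 1) (hBcont : ∀ j x, Continuous fun t => B t j x)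
    (h1 : ∀ t, (1 + ∑ j, (C j).adjoint * (B t j * C j)) * N t = 1)
    (h2 : ∀ t, N t * (1 + ∑ j, (C j).adjoint * (B t j * C j)) = 1) (hNc : ∀ t, ‖N t‖ ≤ c)
    (hG1 : ∀ t, (1 - ζ • (Q * N t * Q)) * G t = 1)
    (hG2 : ∀ t, G t * (1 - ζ • (Q * N t * Q)) = 1) (hGg : ∀ t, ‖G t‖ ≤ g)
    {ι : Type*} (b : HilbertBasis ι ℂ E) (hHS : ∀ j, hilbertSchmidtSq b (C j * Q) < ∞) :
    (∀ t s, traceNorm (Q * N t * Q * G t - Q * N s * Q * G s) < ∞) ∧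
      ∀ t, Tendsto (fun s => traceNorm (Q * N s * Q * G s - Q * N t * Q * G t)) (𝓝 t) (𝓝 0) := by
  obtain ⟨κ, hκ, hCN⟩ : ∃ κ < ∞, ∀ t j, hilbertSchmidtSq b (C j * N t * Q) ≤ κ := by
    refine ⟨_, ?_, fun t j => hilbertSchmidtSq_mul_inverse_le b (d := ∑ k, ‖C k‖) (h2 t) (hNc t)
      (hB t) (fun k => Finset.single_le_sum (f := fun k => ‖C k‖) (fun _ _ => norm_nonneg _)
      (Finset.mem_univ k)) j⟩
    exact ENNReal.mul_lt_top ENNReal.ofReal_lt_top (ENNReal.sum_lt_top.mpr fun k _ => hHS k)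
  have hX : ∀ t j, hilbertSchmidtSq b (C j * N t * Q * star (G t)) ≤
      ENNReal.ofReal (g ^ 2) * κ := by
    intro t j
    refine (hilbertSchmidtSq_mul_right_le b _ _).trans ?_
    rw [norm_star]
    gcongr
    · exact hGg t
    · exact hCN t j
  have hF : ∀ t j, hilbertSchmidtSq b (C j * N t * Q * G t) < ∞ := fun t j =>
    (hilbertSchmidtSq_mul_right_le b _ _).trans_lt
      (ENNReal.mul_lt_top ENNReal.ofReal_lt_top ((hCN t j).trans_lt hκ))
  have hD : ∀ t s j x, ‖(B t j - B s j) x‖ ≤ 2 * ‖x‖ := fun t s j x => by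
    refine ((B t j - B s j).le_opNorm x).trans ?_
    gcongr
    exact (norm_sub_le _ _).trans (by linarith [hB t j, hB s j])
  have hY : ∀ t s j,
      hilbertSchmidtSq b ((B t j - B s j) * (C j * N t * Q * G t)) < ∞ := fun t s j =>
    (hilbertSchmidtSq_le_of_norm_le b _ (C j * N t * Q * G t) fun x => hD t s j _).trans_lt
      (ENNReal.mul_lt_top ENNReal.ofReal_lt_top (hF t j))
  have hbound : ∀ t s, traceNorm (Q * N s * Q * G s - Q * N t * Q * G t) ≤
      ∑ j, (ENNReal.ofReal (g ^ 2) * κ) ^ (1 / 2 : ℝ) *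
        hilbertSchmidtSq b ((B t j - B s j) * (C j * N t * Q * G t)) ^ (1 / 2 : ℝ) := by
    intro t s
    rw [resolvent_sub_eq_sum hQ (hN s) (h1 t) (h2 s) (hG1 t) (hG1 s) (hG2 s)]
    refine (traceNorm_sum_adjoint_mul_le b _ _).trans (Finset.sum_le_sum fun j _ => ?_)
    gcongr
    exact hX s j
  have hκ' : (ENNReal.ofReal (g ^ 2) * κ) ^ (1 / 2 : ℝ) < ∞ :=
    ENNReal.rpow_lt_top_of_nonneg (by norm_num) (ENNReal.mul_lt_top ENNReal.ofReal_lt_top hκ).ne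
  refine ⟨fun t s => (hbound s t).trans_lt (ENNReal.sum_lt_top.mpr fun j _ =>
    ENNReal.mul_lt_top hκ' (ENNReal.rpow_lt_top_of_nonneg (by norm_num) (hY s t j).ne)),
    fun t => ?_⟩
  refine tendsto_of_tendsto_of_tendsto_of_le_of_le tendsto_const_nhds ?_
    (fun _ => zero_le) (hbound t)
  have hterm : ∀ j, Tendsto (fun s => (ENNReal.ofReal (g ^ 2) * κ) ^ (1 / 2 : ℝ) *
      hilbertSchmidtSq b ((B t j - B s j) * (C j * N t * Q * G t)) ^ (1 / 2 : ℝ)) (𝓝 t) (𝓝 0) := by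
    intro j
    have h3 : Tendsto (fun s => hilbertSchmidtSq b ((B t j - B s j) * (C j * N t * Q * G t)))
        (𝓝 t) (𝓝 0) := by
      refine tendsto_hilbertSchmidtSq_mul b (fun x => ?_) (fun s x => hD t s j x) (hF t j)
      simpa using ((hBcont j x).tendsto t).const_sub (B t j x)
    have h4 := h3.ennrpow_const (1 / 2 : ℝ)
    rw [ENNReal.zero_rpow_of_pos (by norm_num)] at h4
    simpa only [mul_zero] using ENNReal.Tendsto.const_mul h4 (Or.inr hκ'.ne)
  simpa only [Finset.sum_const_zero] using
    tendsto_finsetSum Finset.univ fun j _ => hterm j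

end Perturbation

/-! ### Existence of the form sums and continuity of their resolvents -/

theorem lemma7p7 {E : Type*} [NormedAddCommGroup E] [InnerProductSpace ℂ E] [CompleteSpace E]
    -- the unperturbed operator
    (H₀ : E →ₗ.[ℂ] E) (hH₀ : IsSelfAdjoint H₀) (hH₀_below : H₀.BddBelow)
    -- the operators `A j` and `S j`
    {n : ℕ} (A : Fin n → E →ₗ.[ℂ] E) (hA_closed : ∀ j, (A j).IsClosed)
    (S : Fin n → E →L[ℂ] E) (hS_norm : ∀ j, ‖S j‖ ≤ 1)
    (hA_init : ∀ j : Fin n, (j : ℕ) + 1 < n →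
      ((A j).IsFormBoundedLTOne H₀ ∧ (S j).IsPositive) ∨ (A j).IsInfFormBounded H₀)
    (hA_last : ∀ j : Fin n, (j : ℕ) + 1 = n → (A j).IsFormBoundedLTOne H₀)
    -- `A j` times the resolvent of `H₀` is Hilbert-Schmidt
    (hA_HS : ∀ j, ∃ (z : ℂ) (R T : E →L[ℂ] E), H₀.IsResolventAt z R ∧
      (∀ x, ∃ h : R x ∈ (A j).domain, A j ⟨R x, h⟩ = T x) ∧ IsHilbertSchmidt T)
    -- the strongly continuous family `K`
    (K : Set.Icc (0 : ℝ) 1 → E →L[ℂ] E) (hK_cont : ∀ x, Continuous fun ε => K ε x)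
    (hK_zero : K 0 = 0) (hK_one : K 1 = 1)
    (hK_sa : ∀ ε, IsSelfAdjoint (K ε)) (hK_nonneg : ∀ ε, 0 ≤ K ε) (hK_le : ∀ ε, K ε ≤ 1)
    -- `K ε * S j` is self-adjoint, that is, `S j` is self-adjoint and commutes with `K ε`
    (hKS : ∀ ε j, IsSelfAdjoint (K ε * S j)) :
    -- the form sums exist and are self-adjoint
    ∃ H : Set.Icc (0 : ℝ) 1 → E →ₗ.[ℂ] E,
      (∀ ε, H₀.IsFormSum A (fun j => K ε * S j) (H ε)) ∧
      (∀ ε, IsSelfAdjoint (H ε)) ∧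
      -- the resolvents are continuous in trace norm
      ∀ z : ℂ, z.im ≠ 0 → ∃ R : Set.Icc (0 : ℝ) 1 → E →L[ℂ] E,
        (∀ ε, (H ε).IsResolventAt z (R ε)) ∧
        (∀ ε ε', traceNorm (R ε - R ε') < ∞) ∧
        ∀ ε, Tendsto (fun ε' => traceNorm (R ε' - R ε)) (𝓝 ε) (𝓝 0) := by
  obtain ⟨a, b, α, hab, hα⟩ := exists_formBounds hA_init hA_last
  have hH₀_symm := LinearPMap.isSymm_of_isSelfAdjoint hH₀
  obtain ⟨γ, hγ⟩ := id hH₀_below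
  -- the shift `lam` is so large that the constants `b j` add less than `1 - ∑ α j` to the bounds
  have hδ : 0 < 1 - ∑ j, α j := by linarith
  have hb : 0 ≤ ∑ j, b j := Finset.sum_nonneg fun j _ => (hab j).2.1
  obtain ⟨lam, hlam, hlamγ, hβ⟩ : ∃ lam : ℝ, 0 ≤ lam ∧ 0 < lam + γ ∧
      ∑ j, (α j + b j * (lam + γ)⁻¹) < 1 := by
    have h0 : 0 ≤ 2 * (∑ j, b j) / (1 - ∑ j, α j) := by positivity
    refine ⟨2 * (∑ j, b j) / (1 - ∑ j, α j) + 1 + |γ| - γ, ?_, ?_, ?_⟩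
    · linarith [le_abs_self γ]
    · linarith [abs_nonneg γ]
    · have hL : 0 < 2 * (∑ j, b j) / (1 - ∑ j, α j) + 1 + |γ| := by positivity
      rw [Finset.sum_add_distrib, ← Finset.sum_mul, sub_add_cancel, ← lt_sub_iff_add_lt',
        ← div_eq_mul_inv, div_lt_iff₀ hL, mul_add, mul_add, mul_div_cancel₀ _ hδ.ne']
      have : 0 ≤ (1 - ∑ j, α j) * |γ| := by positivity
      linarith
  obtain ⟨Q, hQ, hQn⟩ := LinearPMap.exists_isInvSqrt hH₀ hγ hlamγ
  choose C hC hCn using fun j => hQ.exists_comp_eq hH₀_symm hH₀_below hlam (hab j).1 (hab j).2.1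
    (hab j).2.2.2.1
  have hS_sa : ∀ j, IsSelfAdjoint (S j) := fun j => by simpa [hK_one] using hKS 1 j
  have hB : ∀ ε j, ‖K ε * S j‖ ≤ 1 := fun ε j =>
    (norm_mul_le _ _).trans (mul_le_one₀
      ((CStarAlgebra.norm_le_one_iff_of_nonneg (K ε) (hK_nonneg ε)).mpr (hK_le ε))
      (norm_nonneg _) (hS_norm j))
  have hBC : ∀ ε j f, -((α j + b j * (lam + γ)⁻¹) * ‖f‖ ^ 2) ≤
      (⟪(K ε * S j) (C j f), C j f⟫_ℂ).re := by
    intro ε j f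
    obtain ⟨-, hbj, hαj, -, hpos | hle⟩ := hab j
    · have hcomm : Commute (K ε) (S j) := ((hK_sa ε).commute_iff (hS_sa j)).mpr (hKS ε j)
      have h1 : 0 ≤ K ε * S j := Commute.mul_nonneg (hK_nonneg ε)
        ((ContinuousLinearMap.nonneg_iff_isPositive _).mpr hpos) hcomm
      have h2 := ((ContinuousLinearMap.nonneg_iff_isPositive _).mp h1).re_inner_nonneg_left (C j f)
      refine le_trans ?_ h2
      have h3 : 0 ≤ (α j + b j * (lam + γ)⁻¹) * ‖f‖ ^ 2 := by positivity
      linarith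
    · have h1 : ‖⟪(K ε * S j) (C j f), C j f⟫_ℂ‖ ≤ ‖C j f‖ ^ 2 := by
        refine (norm_inner_le_norm _ _).trans ?_
        rw [sq]
        gcongr
        exact ((K ε * S j).le_opNorm _).trans (mul_le_of_le_one_left (norm_nonneg _) (hB ε j))
      have h2 : ‖C j f‖ ^ 2 ≤ (α j + b j * (lam + γ)⁻¹) * ‖f‖ ^ 2 := by
        refine (hCn j f).trans ?_
        rw [add_mul, mul_assoc]
        gcongr
        exact hQn f
      have h3 := neg_le_of_abs_le ((Complex.abs_re_le_norm _).trans (h1.trans h2))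
      exact h3
  choose N hMN hNM hNc using fun ε => exists_inverse_one_add_sum hβ (hBC ε)
  have hN_sa : ∀ ε, IsSelfAdjoint (N ε) := by
    intro ε
    refine isSelfAdjoint_of_mul_eq_one ?_ (hMN ε)
    refine IsSelfAdjoint.add (.one _) (isSelfAdjoint_sum _ fun j _ => ?_)
    rw [← mul_assoc]
    exact (hKS ε j).conjugate' (C j)
  have hinj : ∀ ε, Function.Injective (Q * N ε * Q) := by
    intro ε
    have hNinj : Function.Injective (N ε) :=
      Function.LeftInverse.injective fun x => ContinuousLinearMap.apply_apply_of_mul_eq_one (hMN ε) x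
    exact (hQ.injective.comp hNinj).comp hQ.injective
  have hR_sa : ∀ ε, IsSelfAdjoint (Q * N ε * Q) := fun ε => by
    have := (hN_sa ε).conjugate Q
    rwa [hQ.isSelfAdjoint.star_eq] at this
  refine ⟨fun ε => LinearPMap.ofResolvent (Q * N ε * Q) (hinj ε) ((-lam : ℝ) : ℂ),
    fun ε => hQ.isFormSum_ofResolvent hH₀_symm hH₀_below hC (hMN ε) (hNM ε) (hinj ε),
    fun ε => LinearPMap.isSelfAdjoint_ofResolvent (hinj ε) (hR_sa ε) (-lam), fun z hz => ?_⟩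
  have hζ : (z - ((-lam : ℝ) : ℂ)).im ≠ 0 := by simpa using hz
  choose G hG1 hG2 hGn using fun ε => (hR_sa ε).exists_inverse_one_sub_smul hζ
  obtain ⟨s, e, -⟩ := exists_hilbertBasis ℂ E
  have hHS : ∀ j, hilbertSchmidtSq e (C j * Q) < ∞ := by
    intro j
    obtain ⟨w, R, F, hR, hF, hFHS⟩ := hA_HS j
    exact hQ.hilbertSchmidtSq_comp_lt_top (hC j) hR hF hFHS e
  exact ⟨fun ε => Q * N ε * Q * G ε,
    fun ε => LinearPMap.isResolventAt_ofResolvent (hinj ε) (hG1 ε) (hG2 ε),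
    traceNorm_sub_lt_top_and_tendsto hQ.isSelfAdjoint hN_sa hB (fun j x => hK_cont (S j x))
      hMN hNM hNc hG1 hG2 hGn e hHS⟩
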